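/- Consider the elliptic Sitnikov problem $$\ddot x+F(x,t,e)=0,\qquad F(x,t,e)=\frac{x}{\left(x^2+r(t,e)^2\right)^{3/2}},\qquad r(t,e)=\tfrac12\bigl(1-e\cos u(t,e)\bigr),$$ where $e\in[0,1)$ is the eccentricity and $u=u(t,e)$ is the solution of Kepler's equation $u-e\sin u=t$. For $\xi>0$ let $X(t,\xi,e)$ be the solution with $X(0,\xi,e)=\xi$, $\dot X(0,\xi,e)=0$. Let $m,p\ge 1$ be integers. A *family of even $(m,p)$-periodic solutions* emanating from the circular problem ($e=0$) is a family $\varphi_{m,p}(t,e)=X(t,\Xi(e),e)$, $0\le e<e_0$, where $0<e_0\le 1$ and $\Xi:[0,e_0)\to\mathbb R$ is a continuously differentiable function such that $\Xi(0)>0$, the solution $X(\cdot,\Xi(0),0)$ has minimal period $2m\pi/p$, and $\dot X(m\pi,\Xi(e),e)=0$ for all $e\in[0,e_0)$. Let $\tau_{m,p}(e)=\psi_1(2m\pi,e)+\dot\psi_2(2m\pi,e)$ be the trace of the $2m\pi$-Poincaré matrix of the linearized equation $$\ddot y+q(t,e)\,y=0,\qquad q(t,e)=\frac{\partial F}{\partial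 x}\bigl(\varphi_{m,p}(t,e),t,e\bigr),$$ where $\psi_1,\psi_2$ are its solutions with initial values $(\psi_1,\dot\psi_1)(0)=(1,0)$ and $(\psi_2,\dot\psi_2)(0)=(0,1)$. **Theorem 4.3.** Let $1\le p\le\lfloor\sqrt8\,m\rfloor$ and suppose that $\dfrac pm\ne\dfrac1{2n}$ for every integer $n\ge1$. Then a family of even $(m,p)$-periodic solutions as above exists, and for every such family $\tau_{m,p}$ is (one-sidedly) differentiable at $e=0$ with $$\tau_{m,p}'(0)=0.$$ -/

import Mathlib

namespace Sitnikov

/-- `x` is a solution, on the whole time line, of the scalar second order initial value problem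
`ẍ + g(x, t) = 0`, `x(0) = a`, `ẋ(0) = b`. -/
structure IsIVPSolution (g : ℝ → ℝ → ℝ) (a b : ℝ) (x : ℝ → ℝ) : Prop where
  differentiable : Differentiable ℝ x
  ode : ∀ t, HasDerivAt (deriv x) (-(g (x t) t)) t
  init : x 0 = a
  init_deriv : deriv x 0 = b

/-- The solution of `ẍ + g(x, t) = 0`, `x(0) = a`, `ẋ(0) = b`. It is used below only for `g` that are
continuous, and Lipschitz in `x` locally uniformly in `t`, so that there is exactly one solution
on the whole time line. -/
noncomputable def ivpSolution (g : ℝ → ℝ → ℝ) (a b : ℝ) : ℝ → ℝ :=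
  Classical.epsilon (IsIVPSolution g a b)

/-- The trace `ψ₁(T) + ψ₂'(T)` of the `T`-Poincaré matrix of Hill's equation `ÿ + q(t) y = 0`, where
`ψ₁`, `ψ₂` are the fundamental solutions, with initial data `(1, 0)` and `(0, 1)`. -/
noncomputable def hillTrace (q : ℝ → ℝ) (T : ℝ) : ℝ :=
  ivpSolution (fun y t => q t * y) 1 0 T + deriv (ivpSolution (fun y t => q t * y) 0 1) T

/-- `T` is the minimal period of `x`: the least positive period. -/
def HasMinimalPeriod (x : ℝ → ℝ) (T : ℝ) : Prop :=
  IsLeast {S : ℝ | 0 < S ∧ Function.Periodic x S} T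

theorem kepler_bijective {e : ℝ} (he : |e| < 1) :
    Function.Bijective (fun u : ℝ => u - e * Real.sin u) := by
  obtain ⟨h1, h2⟩ := abs_lt.mp he
  have hmono : StrictMono (fun u : ℝ => u - e * Real.sin u) := by
    apply strictMono_of_deriv_pos
    intro u
    have hd : HasDerivAt (fun u : ℝ => u - e * Real.sin u) (1 - e * Real.cos u) u :=
      (hasDerivAt_id u).sub ((Real.hasDerivAt_sin u).const_mul e)
    rw [hd.deriv]
    have hc : |e * Real.cos u| < 1 := by
      rw [abs_mul]
      calc |e| * |Real.cos u| ≤ |e| * 1 :=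
            mul_le_mul_of_nonneg_left (Real.abs_cos_le_one u) (abs_nonneg e)
        _ < 1 := by linarith
    linarith [(abs_lt.mp hc).2]
  have hb : ∀ u : ℝ, |e * Real.sin u| ≤ 1 := fun u => by
    rw [abs_mul]
    calc |e| * |Real.sin u| ≤ 1 * 1 :=
          mul_le_mul he.le (Real.abs_sin_le_one u) (abs_nonneg _) zero_le_one
      _ = 1 := one_mul 1
  refine ⟨hmono.injective, Continuous.surjective (by fun_prop) ?_ ?_⟩
  · refine Filter.tendsto_atTop_mono (f := fun u : ℝ => u - 1) (fun u => ?_)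
      (Filter.tendsto_atTop_add_const_right _ (-1) Filter.tendsto_id)
    linarith [(abs_le.mp (hb u)).2]
  · have h : Filter.Tendsto (fun u : ℝ => u + 1) Filter.atBot Filter.atBot :=
      Filter.tendsto_atBot_add_const_right Filter.atBot (1 : ℝ) Filter.tendsto_id
    refine Filter.tendsto_atBot_mono (fun u => ?_) h
    linarith [(abs_le.mp (hb u)).1]

/-- The solution `u = u(t, e)` of Kepler's equation `u - e sin u = t`. -/
noncomputable def kepler (t e : ℝ) : ℝ :=
  Function.invFun (fun u : ℝ => u - e * Real.sin u) t

theorem kepler_iff {t e u : ℝ} (he : |e| < 1) : kepler t e = u ↔ u - e * Real.sin u = t := by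
  constructor
  · rintro rfl
    exact Function.rightInverse_invFun (kepler_bijective he).surjective t
  · rintro rfl
    exact Function.leftInverse_invFun (kepler_bijective he).injective u

/-- `r(t, e) = r₀ (1 - e cos u(t, e))` with `r₀ = 1 / 2`. -/
noncomputable def radius (t e : ℝ) : ℝ :=
  1 / 2 * (1 - e * Real.cos (kepler t e))

/-- The force term `F(x, t, e) = x / (x² + r(t, e)²) ^ (3 / 2)` of the elliptic Sitnikov problem
`ẍ + F(x, t, e) = 0`. -/
noncomputable def F (x t e : ℝ) : ℝ :=
  x / (x ^ 2 + radius t e ^ 2) ^ (3 / 2 : ℝ)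

/-- `X(t, ξ, e)`: the solution of `ẍ + F(x, t, e) = 0` with `x(0) = ξ`, `ẋ(0) = 0`. -/
noncomputable def X (t ξ e : ℝ) : ℝ :=
  ivpSolution (fun x s => F x s e) ξ 0 t

/-- `Ξ` parametrizes, for eccentricities `e ∈ [0, e₀)`, a family `φ(t, e) = X(t, Ξ(e), e)` of even
`2mπ`-periodic solutions of the elliptic Sitnikov problem that emanates from the even solution
`φ(t, 0)` of the circular problem with `φ(0, 0) > 0` and of minimal period `2mπ / p`. -/
structure IsEvenFamily (m p : ℕ) (e₀ : ℝ) (Ξ : ℝ → ℝ) : Prop where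
  pos : 0 < e₀
  le_one : e₀ ≤ 1
  contDiffOn : ContDiffOn ℝ 1 Ξ (Set.Ico 0 e₀)
  start_pos : 0 < Ξ 0
  start_period : HasMinimalPeriod (fun t => X t (Ξ 0) 0) (2 * m * Real.pi / p)
  deriv_eq_zero : ∀ e ∈ Set.Ico 0 e₀, deriv (fun t => X t (Ξ e) e) (m * Real.pi) = 0

/-- The trace `τ(e)` of the `2mπ`-Poincaré matrix of the linearization `ÿ + q(t, e) y = 0`,
`q(t, e) = ∂F/∂x (φ(t, e), t, e)`, of the Sitnikov equation along `φ(t, e) = X(t, Ξ(e), e)`. -/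
noncomputable def trace (m : ℕ) (Ξ : ℝ → ℝ) (e : ℝ) : ℝ :=
  hillTrace (fun t => deriv (fun x => F x t e) (X t (Ξ e) e)) (2 * m * Real.pi)

end Sitnikov

/-!
At `e = 0` the equation is autonomous, and its oscillations have every frequency below `√8`, the
small amplitude limit; this gives a solution of the circular problem with quarter period
`s = mπ / (2p)`. Its linearization has the fundamental solutions `ψ₁`, even, and
`ψ₂ = -Ẋ / F(ξ, 0, 0)`. Comparing `ψ₁` with `X` (Sturm) shows `ψ₁ > 0` on `[0, s]`, and the
half-period translation then gives `ψ̇₁(2ks) ≠ 0` for `k ≠ 0`. As `∂Ẋ/∂ξ = ψ̇₁`, the implicit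
function theorem applied to `Ẋ(mπ, ξ, e) = 0` produces the family.

Along any family, write `δ` for the derivative at `e = 0` and `T = 2mπ`. The Poincaré matrix at
`e = 0` is parabolic, so that Green's identity gives `δψ₁(T) + δψ̇₂(T) = δψ₂(T) ψ̇₁(T)`. In
`w = δẊ + F(ξ, 0, 0) δψ₂` the variations of the coefficient cancel, leaving
`ẅ + q w = a(X) sin t`, where `∂F/∂e = a(X) cos t`. Pairing `w` with `Ẋ` and using `δẊ(T) = 0`,
one finds that `δψ₂(T)` is a multiple of the first Fourier coefficient `∫₀ᵀ a(X) Ẋ sin t dt`. As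
`a` is odd, `a(X) Ẋ` has the period `2s = mπ / p`, and the coefficient vanishes unless `2s` is a
multiple of `2π`, that is, `p / m = 1 / (2n)`.
-/

namespace Sitnikov

open Set Filter Topology Function
open scoped NNReal BoundedContinuousFunction

section GlobalExistence

variable {E : Type*} [NormedAddCommGroup E] [NormedSpace ℝ E]

theorem norm_integral_le_of_norm_le_cosh {g : ℝ → E} {C l : ℝ} (hl : 0 < l)
    (hg : ∀ s, ‖g s‖ ≤ C * Real.cosh (l * s)) (t : ℝ) :
    ‖∫ s in (0 : ℝ)..t, g s‖ ≤ C / l * Real.cosh (l * t) := by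
  have hC : 0 ≤ C := by simpa using (norm_nonneg _).trans (hg 0)
  have hsinh : |Real.sinh (l * t)| ≤ Real.cosh (l * t) :=
    abs_le.2 ⟨by linarith [Real.cosh_add_sinh (l * t), Real.exp_pos (l * t)],
      (Real.sinh_lt_cosh _).le⟩
  have hint : ∫ s in (0 : ℝ)..t, Real.cosh (l * s) = Real.sinh (l * t) / l := by
    have hd (s : ℝ) : HasDerivAt (fun s => Real.sinh (l * s) / l) (Real.cosh (l * s)) s := by
      refine (((hasDerivAt_id s).const_mul l).sinh.div_const l).congr_deriv ?_
      rw [mul_one, mul_div_cancel_right₀ _ hl.ne', id]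
    simpa using intervalIntegral.integral_eq_sub_of_hasDerivAt (a := 0) (b := t)
      (fun s _ => hd s) (Continuous.intervalIntegrable (by fun_prop) _ _)
  calc ‖∫ s in (0 : ℝ)..t, g s‖ ≤ |∫ s in (0 : ℝ)..t, C * Real.cosh (l * s)| :=
        intervalIntegral.norm_integral_le_abs_of_norm_le (Eventually.of_forall fun s => hg s)
          (Continuous.intervalIntegrable (by fun_prop) _ _)
    _ = C / l * |Real.sinh (l * t)| := by
        rw [intervalIntegral.integral_const_mul, hint, abs_mul, abs_div, abs_of_nonneg hC,
          abs_of_pos hl]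
        ring
    _ ≤ C / l * Real.cosh (l * t) := by gcongr

/-- The Picard operator `z ↦ x₀ + ∫₀ᵗ f(s, z(s)) ds` of the initial value problem `ż = f(t, z)`,
`z(0) = x₀`, acting on `w = z / cosh (l t)`. For large `l` this weight makes it a contraction on the
bounded functions on the whole line, when `f` is globally Lipschitz in space. -/
noncomputable def weightedPicard (l : ℝ) (f : ℝ → E → E) (x₀ : E) (w : ℝ → E) (t : ℝ) : E :=
  (Real.cosh (l * t))⁻¹ • (x₀ + ∫ s in (0 : ℝ)..t, f s (Real.cosh (l * s) • w s))

variable {f : ℝ → E → E} {x₀ : E} {l : ℝ}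

theorem continuous_weightedPicard_integrand (hf : Continuous (uncurry f)) {w : ℝ → E}
    (hw : Continuous w) : Continuous fun s => f s (Real.cosh (l * s) • w s) :=
  hf.comp (f := fun s => (s, Real.cosh (l * s) • w s)) (by fun_prop)

theorem continuous_weightedPicard (hf : Continuous (uncurry f)) {w : ℝ → E} (hw : Continuous w) :
    Continuous (weightedPicard l f x₀ w) :=
  (Continuous.inv₀ (by fun_prop) fun _ => (Real.cosh_pos _).ne').smul
    (continuous_const.add (intervalIntegral.continuous_primitive
      (fun _ _ => (continuous_weightedPicard_integrand hf hw).intervalIntegrable _ _) 0))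

theorem norm_weightedPicard_sub_le (hf : Continuous (uncurry f)) {K : ℝ≥0}
    (hK : ∀ t, LipschitzWith K (f t)) (hl : 0 < l) (w v : ℝ →ᵇ E) (t : ℝ) :
    ‖weightedPicard l f x₀ w t - weightedPicard l f x₀ v t‖ ≤ K / l * dist w v := by
  have hc (t : ℝ) : 0 < Real.cosh (l * t) := Real.cosh_pos _
  have hcont (u : ℝ →ᵇ E) := continuous_weightedPicard_integrand (l := l) hf u.continuous
  have hbound (s : ℝ) : ‖f s (Real.cosh (l * s) • w s) - f s (Real.cosh (l * s) • v s)‖ ≤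
      K * dist w v * Real.cosh (l * s) :=
    calc _ ≤ K * (Real.cosh (l * s) * dist (w s) (v s)) := by
          refine ((hK s).norm_sub_le _ _).trans_eq ?_
          rw [← smul_sub, norm_smul, Real.norm_of_nonneg (hc s).le, dist_eq_norm]
      _ ≤ K * (Real.cosh (l * s) * dist w v) := by
          gcongr; exact BoundedContinuousFunction.dist_coe_le_dist s
      _ = _ := by ring
  have hint := norm_integral_le_of_norm_le_cosh hl hbound t
  rw [intervalIntegral.integral_sub ((hcont w).intervalIntegrable _ _)
    ((hcont v).intervalIntegrable _ _)] at hint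
  rw [weightedPicard, weightedPicard, ← smul_sub, norm_smul, norm_inv,
    Real.norm_of_nonneg (hc t).le, inv_mul_le_iff₀ (hc t), add_sub_add_left_eq_sub]
  exact hint.trans_eq (by ring)

theorem norm_weightedPicard_zero_le {C : ℝ} (hC : ∀ t, ‖f t 0‖ ≤ C) (hl : 0 < l) (t : ℝ) :
    ‖weightedPicard l f x₀ 0 t‖ ≤ ‖x₀‖ + C / l := by
  have hC0 : 0 ≤ C := (norm_nonneg _).trans (hC 0)
  have hbound (s : ℝ) : ‖f s (Real.cosh (l * s) • (0 : ℝ → E) s)‖ ≤ C * Real.cosh (l * s) := by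
    rw [Pi.zero_apply, smul_zero]
    exact (hC s).trans (le_mul_of_one_le_right hC0 (Real.one_le_cosh _))
  have hx₀ : ‖x₀‖ ≤ ‖x₀‖ * Real.cosh (l * t) :=
    le_mul_of_one_le_right (norm_nonneg _) (Real.one_le_cosh _)
  rw [weightedPicard, norm_smul, norm_inv, Real.norm_of_nonneg (Real.cosh_pos _).le,
    inv_mul_le_iff₀ (Real.cosh_pos _)]
  refine (norm_add_le _ _).trans ?_
  linarith [norm_integral_le_of_norm_le_cosh hl hbound t]

theorem isIntegralCurve_of_weightedPicard_eq [CompleteSpace E] (hf : Continuous (uncurry f))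
    {w : ℝ → E} (hw : Continuous w) (h : weightedPicard l f x₀ w = w) :
    IsIntegralCurve (fun t => Real.cosh (l * t) • w t) f := by
  have hz : (fun t => Real.cosh (l * t) • w t) =
      fun t => x₀ + ∫ s in (0 : ℝ)..t, f s (Real.cosh (l * s) • w s) := by
    funext t
    nth_rewrite 1 [← h]
    exact smul_inv_smul₀ (Real.cosh_pos _).ne' _
  have hcont := continuous_weightedPicard_integrand (l := l) hf hw
  intro t
  rw [hz]
  refine ((intervalIntegral.integral_hasDerivAt_right (hcont.intervalIntegrable 0 t)
    (hcont.stronglyMeasurableAtFilter _ _) hcont.continuousAt).const_add x₀).congr_deriv ?_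
  exact congrArg (f t) (congrFun hz t)

theorem exists_isIntegralCurve_of_lipschitzWith [CompleteSpace E] (hf : Continuous (uncurry f))
    {K : ℝ≥0} (hK : ∀ t, LipschitzWith K (f t)) {C : ℝ} (hC : ∀ t, ‖f t 0‖ ≤ C) (x₀ : E) :
    ∃ z : ℝ → E, z 0 = x₀ ∧ IsIntegralCurve z f := by
  have hl : (0 : ℝ) < K + 1 := by positivity
  have hdist := norm_weightedPicard_sub_le (x₀ := x₀) hf hK hl
  let Φ (w : ℝ →ᵇ E) : ℝ →ᵇ E :=
    .ofNormedAddCommGroup (weightedPicard (K + 1) f x₀ w)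
      (continuous_weightedPicard hf w.continuous) (K / (K + 1) * dist w 0 + (‖x₀‖ + C / (K + 1)))
      fun t => (norm_le_norm_sub_add _ (weightedPicard (K + 1) f x₀ (0 : ℝ →ᵇ E) t)).trans
        (add_le_add (hdist w 0 t) (norm_weightedPicard_zero_le hC hl t))
  have hΦ : ContractingWith (K / (K + 1)) Φ := by
    refine ⟨(div_lt_one (by positivity)).2 (lt_add_one K),
      LipschitzWith.of_dist_le_mul fun w v => ?_⟩
    rw [BoundedContinuousFunction.dist_le (by positivity)]
    intro t
    rw [dist_eq_norm]
    push_cast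
    exact hdist w v t
  let w := ContractingWith.fixedPoint Φ hΦ
  have hw : weightedPicard (K + 1) f x₀ w = w :=
    congrArg DFunLike.coe (hΦ.fixedPoint_isFixedPt : Φ w = w)
  refine ⟨_, ?_, isIntegralCurve_of_weightedPicard_eq hf w.continuous hw⟩
  rw [← hw]
  simp [weightedPicard]

end GlobalExistence

section SmoothDependence

variable {E : Type*} [NormedAddCommGroup E] [NormedSpace ℝ E]

theorem hasDerivWithinAt_Ici_of_Icc {f : ℝ → E} {f' : E} {a b t : ℝ} (ht : t ∈ Ico a b)
    (h : HasDerivWithinAt f f' (Icc a b) t) : HasDerivWithinAt f f' (Ici t) t :=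
  h.mono_of_mem_nhdsWithin (Icc_mem_nhdsGE_of_mem ht)

theorem norm_sub_le_mul_exp {v : ℝ → E → E} {z w : ℝ → E} {T K : ℝ}
    (hz : IsIntegralCurveOn z v (Icc 0 T)) (hw : IsIntegralCurveOn w v (Icc 0 T))
    (hv : ∀ t ∈ Ico 0 T, ‖v t (w t) - v t (z t)‖ ≤ K * ‖w t - z t‖) :
    ∀ t ∈ Icc 0 T, ‖w t - z t‖ ≤ ‖w 0 - z 0‖ * Real.exp (K * t) := by
  intro t ht
  have hd (s : ℝ) (hs : s ∈ Icc 0 T) := (hw s hs).sub (hz s hs)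
  have := norm_le_gronwallBound_of_norm_deriv_right_le (δ := ‖w 0 - z 0‖) (K := K) (ε := 0)
    (fun s hs => (hd s hs).continuousWithinAt)
    (fun s hs => hasDerivWithinAt_Ici_of_Icc hs (hd s (Ico_subset_Icc_self hs))) le_rfl
    (fun s hs => by simpa using hv s hs) t ht
  simpa [gronwallBound_ε0] using this

theorem norm_sub_le_of_forall_tube {v : ℝ → E → E} {z w : ℝ → E} {T K δ : ℝ} (hK : 0 ≤ K)
    (hz : IsIntegralCurveOn z v (Icc 0 T)) (hw : IsIntegralCurveOn w v (Icc 0 T))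
    (hv : ∀ t ∈ Icc 0 T, ∀ x, ‖x - z t‖ ≤ δ → ‖v t x - v t (z t)‖ ≤ K * ‖x - z t‖)
    (h : ‖w 0 - z 0‖ * Real.exp (K * T) < δ) :
    ∀ t ∈ Icc 0 T, ‖w t - z t‖ ≤ ‖w 0 - z 0‖ * Real.exp (K * T) := by
  have hcont : ContinuousOn (fun t => w t - z t) (Icc 0 T) := hw.continuousOn.sub hz.continuousOn
  have hbound (t₁ : ℝ) (ht₁ : t₁ ∈ Icc 0 T) (htube : ∀ t ∈ Ico 0 t₁, ‖w t - z t‖ ≤ δ) :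
      ‖w t₁ - z t₁‖ ≤ ‖w 0 - z 0‖ * Real.exp (K * T) := by
    have hsub : Icc 0 t₁ ⊆ Icc 0 T := Icc_subset_Icc_right ht₁.2
    refine (norm_sub_le_mul_exp (hz.mono hsub) (hw.mono hsub)
      (fun t ht => hv t (hsub (Ico_subset_Icc_self ht)) _ (htube t ht)) t₁
      (right_mem_Icc.2 ht₁.1)).trans ?_
    gcongr
    exact ht₁.2
  -- The first exit time from the tube would contradict the estimate up to that time.
  have htube : ∀ t ∈ Icc 0 T, ‖w t - z t‖ < δ := by
    by_contra! ⟨t, ht, htδ⟩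
    have hexit : IsCompact {t ∈ Icc 0 T | δ ≤ ‖w t - z t‖} :=
      isCompact_Icc.of_isClosed_subset
        (hcont.norm.preimage_isClosed_of_isClosed isClosed_Icc isClosed_Ici) fun t ht => ht.1
    obtain ⟨t₁, ht₁, hleast⟩ := hexit.exists_isLeast ⟨t, ht, htδ⟩
    have := hbound t₁ ht₁.1 fun s hs => by
      by_contra! hs'
      exact hs.2.not_ge (hleast ⟨⟨hs.1, hs.2.le.trans ht₁.1.2⟩, hs'.le⟩)
    linarith [ht₁.2]
  exact fun t ht => hbound t ht fun s hs => (htube s ⟨hs.1, hs.2.le.trans ht.2⟩).le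

theorem eventually_forall_norm_sub_sub_fderiv_le {V : E → E} {U C : Set E} (hU : IsOpen U)
    (hV : ContDiffOn ℝ 1 V U) (hC : IsCompact C) (hCU : C ⊆ U) {ε : ℝ} (hε : 0 < ε) :
    ∀ᶠ h in 𝓝 (0 : E), ∀ x ∈ C, ‖V (x + h) - V x - fderiv ℝ V x h‖ ≤ ε * ‖h‖ := by
  refine hC.eventually_forall_of_forall_eventually fun x hx => ?_
  have hVx : ContDiffAt ℝ 1 V x := hV.contDiffAt (hU.mem_nhds (hCU hx))
  have hlim : Tendsto (fun z : E × E => (z.2 + z.1, z.2)) (𝓝 (0, x)) (𝓝 (x, x)) :=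
    Continuous.tendsto' (by fun_prop) _ _ (by simp)
  have hstrict : ∀ᶠ z : E × E in 𝓝 (0, x),
      ‖V (z.2 + z.1) - V z.2 - fderiv ℝ V x z.1‖ ≤ ε / 2 * ‖z.1‖ := by
    have := (hVx.hasStrictFDerivAt one_ne_zero).isLittleO.def (half_pos hε)
    simpa using hlim.eventually this
  have hfderiv : ∀ᶠ z : E × E in 𝓝 (0, x), ‖fderiv ℝ V z.2 - fderiv ℝ V x‖ < ε / 2 := by
    have hlim' : Tendsto (fun z : E × E => fderiv ℝ V z.2) (𝓝 (0, x)) (𝓝 (fderiv ℝ V x)) :=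
      (hVx.fderiv_right (m := 0) (by norm_num)).continuousAt.tendsto.comp
        (continuous_snd.tendsto (0, x))
    filter_upwards [hlim' (Metric.ball_mem_nhds _ (half_pos hε))] with z hz
    simpa [dist_eq_norm] using hz
  filter_upwards [hstrict, hfderiv] with ⟨h, y⟩ hstrict hfderiv
  calc ‖V (y + h) - V y - fderiv ℝ V y h‖
      = ‖(V (y + h) - V y - fderiv ℝ V x h) - (fderiv ℝ V y - fderiv ℝ V x) h‖ := by simp
    _ ≤ ε / 2 * ‖h‖ + ε / 2 * ‖h‖ := (norm_sub_le _ _).trans <| add_le_add hstrict <|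
        (fderiv ℝ V y - fderiv ℝ V x).le_of_opNorm_le hfderiv.le h
    _ = ε * ‖h‖ := by ring

section Trajectory

variable {V : E → E} {U : Set E} {T : ℝ} {z : ℝ → E}

theorem exists_norm_fderiv_trajectory_le (hU : IsOpen U) (hV : ContDiffOn ℝ 1 V U)
    (hz : ContinuousOn z (Icc 0 T)) (hzU : MapsTo z (Icc 0 T) U) :
    ∃ K, 0 ≤ K ∧ ∀ t ∈ Icc 0 T, ‖fderiv ℝ V (z t)‖ ≤ K := by
  obtain ⟨K, hK⟩ := isCompact_Icc.exists_bound_of_continuousOn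
    ((hV.continuousOn_fderiv_of_isOpen hU le_rfl).comp hz hzU)
  exact ⟨max K 0, le_max_right _ _, fun t ht => (hK t ht).trans (le_max_left _ _)⟩

theorem exists_norm_sub_sub_fderiv_trajectory_le (hU : IsOpen U) (hV : ContDiffOn ℝ 1 V U)
    (hz : ContinuousOn z (Icc 0 T)) (hzU : MapsTo z (Icc 0 T) U) {ε : ℝ} (hε : 0 < ε) :
    ∃ δ > 0, ∀ t ∈ Icc 0 T, ∀ x, ‖x - z t‖ < δ →
      ‖V x - V (z t) - fderiv ℝ V (z t) (x - z t)‖ ≤ ε * ‖x - z t‖ := by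
  obtain ⟨δ, hδ, h⟩ := Metric.eventually_nhds_iff.1 (eventually_forall_norm_sub_sub_fderiv_le hU hV
    (isCompact_Icc.image_of_continuousOn hz) hzU.image_subset hε)
  refine ⟨δ, hδ, fun t ht x hx => ?_⟩
  simpa using h (y := x - z t) (by simpa using hx) (z t) ⟨t, ht, rfl⟩

theorem exists_norm_sub_le_mul (hU : IsOpen U) (hV : ContDiffOn ℝ 1 V U)
    (hz : IsIntegralCurveOn z (fun _ => V) (Icc 0 T)) (hzU : MapsTo z (Icc 0 T) U) :
    ∃ C > 0, ∃ δ > 0, ∀ w : ℝ → E, IsIntegralCurveOn w (fun _ => V) (Icc 0 T) →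
      ‖w 0 - z 0‖ < δ → ∀ t ∈ Icc 0 T, ‖w t - z t‖ ≤ C * ‖w 0 - z 0‖ := by
  obtain ⟨K, hK0, hK⟩ := exists_norm_fderiv_trajectory_le hU hV hz.continuousOn hzU
  obtain ⟨δ, hδ, hlin⟩ :=
    exists_norm_sub_sub_fderiv_trajectory_le hU hV hz.continuousOn hzU one_pos
  refine ⟨Real.exp ((K + 1) * T), Real.exp_pos _, δ / 2 / Real.exp ((K + 1) * T), by positivity,
    fun w hw h t ht => ?_⟩
  rw [mul_comm]
  rw [lt_div_iff₀ (Real.exp_pos _)] at h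
  refine norm_sub_le_of_forall_tube (by positivity) hz hw (fun t ht x hx => ?_) h t ht
  calc ‖V x - V (z t)‖
      = ‖(V x - V (z t) - fderiv ℝ V (z t) (x - z t)) + fderiv ℝ V (z t) (x - z t)‖ := by
        rw [sub_add_cancel]
    _ ≤ 1 * ‖x - z t‖ + K * ‖x - z t‖ := (norm_add_le _ _).trans <|
        add_le_add (hlin t ht x (by linarith)) ((fderiv ℝ V (z t)).le_of_opNorm_le (hK t ht) _)
    _ = (K + 1) * ‖x - z t‖ := by ring

theorem norm_sub_sub_le_gronwallBound {w y : ℝ → E} {K η : ℝ}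
    (hz : IsIntegralCurveOn z (fun _ => V) (Icc 0 T))
    (hw : IsIntegralCurveOn w (fun _ => V) (Icc 0 T))
    (hy : IsIntegralCurveOn y (fun t => fderiv ℝ V (z t)) (Icc 0 T)) (hy₀ : y 0 = w 0 - z 0)
    (hK : ∀ t ∈ Icc 0 T, ‖fderiv ℝ V (z t)‖ ≤ K)
    (hη : ∀ t ∈ Icc 0 T, ‖V (w t) - V (z t) - fderiv ℝ V (z t) (w t - z t)‖ ≤ η) :
    ∀ t ∈ Icc 0 T, ‖w t - z t - y t‖ ≤ gronwallBound 0 K η t := by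
  intro t ht
  have hd (s : ℝ) (hs : s ∈ Icc 0 T) := ((hw s hs).sub (hz s hs)).sub (hy s hs)
  rw [show gronwallBound 0 K η t = gronwallBound 0 K η (t - 0) by rw [sub_zero]]
  refine norm_le_gronwallBound_of_norm_deriv_right_le (f := fun t => w t - z t - y t) (δ := 0)
    (fun s hs => (hd s hs).continuousWithinAt)
    (fun s hs => hasDerivWithinAt_Ici_of_Icc hs (hd s (Ico_subset_Icc_self hs)))
    (by simp [hy₀]) (fun s hs => ?_) t ht
  have hs' := Ico_subset_Icc_self hs
  calc ‖V (w s) - V (z s) - fderiv ℝ V (z s) (y s)‖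
      = ‖fderiv ℝ V (z s) (w s - z s - y s) +
          (V (w s) - V (z s) - fderiv ℝ V (z s) (w s - z s))‖ := by
        congr 1; simp only [map_sub]; abel
    _ ≤ K * ‖w s - z s - y s‖ + η := (norm_add_le _ _).trans <|
        add_le_add ((fderiv ℝ V (z s)).le_of_opNorm_le (hK s hs') _) (hη s hs')

theorem gronwallBound_zero_eq_mul (K ε t : ℝ) :
    gronwallBound 0 K ε t = ε * gronwallBound 0 K 1 t := by
  unfold gronwallBound
  split_ifs <;> ring

theorem exists_norm_sub_sub_le (hU : IsOpen U) (hV : ContDiffOn ℝ 1 V U)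
    (hz : IsIntegralCurveOn z (fun _ => V) (Icc 0 T)) (hzU : MapsTo z (Icc 0 T) U)
    {t : ℝ} (ht : t ∈ Icc 0 T) {ε : ℝ} (hε : 0 < ε) :
    ∃ δ > 0, ∀ w y : ℝ → E, IsIntegralCurveOn w (fun _ => V) (Icc 0 T) →
      IsIntegralCurveOn y (fun t => fderiv ℝ V (z t)) (Icc 0 T) → y 0 = w 0 - z 0 →
      ‖y 0‖ < δ → ‖w t - z t - y t‖ ≤ ε * ‖y 0‖ := by
  obtain ⟨K, hK0, hK⟩ := exists_norm_fderiv_trajectory_le hU hV hz.continuousOn hzU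
  obtain ⟨C, hC, δ₁, hδ₁, hlip⟩ := exists_norm_sub_le_mul hU hV hz hzU
  set G := gronwallBound 0 K 1 t with hG
  have hG0 : 0 ≤ G := by
    simpa [gronwallBound_x0] using gronwallBound_mono (δ := 0) le_rfl zero_le_one hK0 ht.1
  set ε' := ε / (C * (G + 1)) with hε'
  obtain ⟨δ₂, hδ₂, hlin⟩ := exists_norm_sub_sub_fderiv_trajectory_le hU hV hz.continuousOn hzU
    (show 0 < ε' by positivity)
  refine ⟨min δ₁ (δ₂ / C), by positivity, fun w y hw hy hy₀ hδ => ?_⟩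
  have hdist (s : ℝ) (hs : s ∈ Icc 0 T) : ‖w s - z s‖ ≤ C * ‖y 0‖ := by
    rw [hy₀] at hδ ⊢
    exact hlip w hw (hδ.trans_le (min_le_left _ _)) s hs
  have hsmall : C * ‖y 0‖ < δ₂ := by
    rw [mul_comm, ← lt_div_iff₀ hC]
    exact hδ.trans_le (min_le_right _ _)
  have herr (s : ℝ) (hs : s ∈ Icc 0 T) :
      ‖V (w s) - V (z s) - fderiv ℝ V (z s) (w s - z s)‖ ≤ ε' * (C * ‖y 0‖) :=
    (hlin s hs _ ((hdist s hs).trans_lt hsmall)).trans (by gcongr; exact hdist s hs)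
  calc ‖w t - z t - y t‖ ≤ ε' * (C * ‖y 0‖) * G := by
        rw [hG, ← gronwallBound_zero_eq_mul]
        exact norm_sub_sub_le_gronwallBound hz hw hy hy₀ hK herr t ht
    _ = ε * ‖y 0‖ * (G / (G + 1)) := by rw [hε']; field_simp
    _ ≤ ε * ‖y 0‖ := mul_le_of_le_one_right (by positivity)
        ((div_le_one (by positivity)).2 (by linarith))

end Trajectory

theorem exists_isIntegralCurveOn_linear [CompleteSpace E] {A : ℝ → E →L[ℝ] E} {T : ℝ} (hT : 0 ≤ T)
    (hA : ContinuousOn A (Icc 0 T)) (x₀ : E) :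
    ∃ y : ℝ → E, y 0 = x₀ ∧ IsIntegralCurveOn y (fun t => A t) (Icc 0 T) := by
  set B : ℝ → E →L[ℝ] E := IccExtend hT (domRestrict (Icc 0 T) A) with hB
  have hBc : Continuous B := (continuousOn_iff_continuous_domRestrict.1 hA).Icc_extend'
  obtain ⟨K, hK⟩ := isCompact_Icc.exists_bound_of_continuousOn hA
  have hBK (t : ℝ) : ‖B t‖₊ ≤ K.toNNReal := by
    rw [← norm_toNNReal]
    exact Real.toNNReal_mono (hK _ (projIcc 0 T hT t).2)
  obtain ⟨y, hy₀, hy⟩ := exists_isIntegralCurve_of_lipschitzWith (f := fun t x => B t x)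
    ((hBc.comp continuous_fst).clm_apply continuous_snd)
    (fun t => (B t).lipschitz.weaken (hBK t)) (fun t => (congrArg norm (map_zero (B t))).le) x₀
  refine ⟨y, hy₀, fun t ht => ?_⟩
  have hBA : B t = A t := by rw [hB, IccExtend_of_mem hT _ ht]; rfl
  simpa only [hBA] using (hy t).hasDerivWithinAt (s := Icc 0 T)

variable {P : Type*} [NormedAddCommGroup P] [NormedSpace ℝ P]

/-- Trajectories `z p`, `p ∈ N`, of the vector field `V` on `[0, T]` that stay in `U` and whose
initial values depend affinely, with linear part `L`, on the parameter `p`. -/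
structure IsTrajectoryFamily (V : E → E) (U : Set E) (T : ℝ) (L : P →L[ℝ] E) (N : Set P)
    (z : P → ℝ → E) : Prop where
  isIntegralCurveOn : ∀ p ∈ N, IsIntegralCurveOn (z p) (fun _ => V) (Icc 0 T)
  mapsTo : ∀ p ∈ N, MapsTo (z p) (Icc 0 T) U
  sub_eq : ∀ p ∈ N, ∀ q ∈ N, z p 0 - z q 0 = L (p - q)

/-- `Y` solves on `[0, T]` the variational equation `Ẏ = DV(z(t)) Y`, `Y(0) = L`, along `z`. -/
structure IsVariationalSolution (V : E → E) (T : ℝ) (L : P →L[ℝ] E) (z : ℝ → E)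
    (Y : ℝ → P →L[ℝ] E) : Prop where
  init : Y 0 = L
  isIntegralCurveOn : IsIntegralCurveOn Y (fun t A => fderiv ℝ V (z t) ∘L A) (Icc 0 T)

theorem IsVariationalSolution.isIntegralCurveOn_apply {V : E → E} {T : ℝ} {L : P →L[ℝ] E}
    {z : ℝ → E} {Y : ℝ → P →L[ℝ] E} (hY : IsVariationalSolution V T L z Y) (h : P) :
    IsIntegralCurveOn (fun t => Y t h) (fun t => fderiv ℝ V (z t)) (Icc 0 T) := fun t ht => by
  simpa using (hY.isIntegralCurveOn t ht).clm_apply (hasDerivWithinAt_const t _ h)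

namespace IsTrajectoryFamily

variable {V : E → E} {U : Set E} {T : ℝ} {L : P →L[ℝ] E} {N : Set P} {z : P → ℝ → E}
  {p : P} {t : ℝ}

theorem hasFDerivAt (hz : IsTrajectoryFamily V U T L N z) (hU : IsOpen U)
    (hV : ContDiffOn ℝ 1 V U) (hN : IsOpen N) (hp : p ∈ N) {Y : ℝ → P →L[ℝ] E}
    (hY : IsVariationalSolution V T L (z p) Y) (ht : t ∈ Icc 0 T) :
    HasFDerivAt (fun q => z q t) (Y t) p := by
  rw [hasFDerivAt_iff_isLittleO]
  refine Asymptotics.IsLittleO.of_bound fun c hc => ?_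
  obtain ⟨δ, hδ, h⟩ := exists_norm_sub_sub_le hU hV (hz.isIntegralCurveOn p hp) (hz.mapsTo p hp) ht
    (show 0 < c / (‖L‖ + 1) by positivity)
  have hsmall : ∀ᶠ q in 𝓝 p, ‖L (q - p)‖ < δ := by
    have : Tendsto (fun q => ‖L (q - p)‖) (𝓝 p) (𝓝 0) :=
      Continuous.tendsto' (by fun_prop) _ _ (by simp)
    exact this.eventually_lt_const hδ
  filter_upwards [hsmall, hN.mem_nhds hp] with q hq hqN
  have hY₀ : Y 0 (q - p) = L (q - p) := by rw [hY.init]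
  have hbound := h (z q) (fun t => Y t (q - p)) (hz.isIntegralCurveOn q hqN)
    (hY.isIntegralCurveOn_apply _) (hY₀.trans (hz.sub_eq q hqN p hp).symm) (by rwa [hY₀])
  refine hbound.trans ?_
  rw [hY₀, div_mul_eq_mul_div, div_le_iff₀ (by positivity), mul_assoc]
  gcongr
  calc ‖L (q - p)‖ ≤ ‖L‖ * ‖q - p‖ := L.le_opNorm _
    _ ≤ ‖q - p‖ * (‖L‖ + 1) := by linarith [norm_nonneg (q - p)]

theorem exists_isVariationalSolution [CompleteSpace E] (hz : IsTrajectoryFamily V U T L N z)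
    (hU : IsOpen U) (hV : ContDiffOn ℝ 1 V U) (hT : 0 ≤ T) (hp : p ∈ N) :
    ∃ Y, IsVariationalSolution V T L (z p) Y := by
  have hA : ContinuousOn (fun t => ContinuousLinearMap.compL ℝ P E E (fderiv ℝ V (z p t)))
      (Icc 0 T) :=
    (ContinuousLinearMap.continuous _).comp_continuousOn <|
      (hV.continuousOn_fderiv_of_isOpen hU le_rfl).comp
        (hz.isIntegralCurveOn p hp).continuousOn (hz.mapsTo p hp)
  obtain ⟨Y, hY₀, hY⟩ := exists_isIntegralCurveOn_linear hT hA L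
  exact ⟨Y, hY₀, hY⟩

theorem continuousOn_variationalSolution (hz : IsTrajectoryFamily V U T L N z) (hU : IsOpen U)
    (hV : ContDiffOn ℝ 2 V U) {Y : P → ℝ → P →L[ℝ] E}
    (hY : ∀ p ∈ N, IsVariationalSolution V T L (z p) (Y p)) (ht : t ∈ Icc 0 T) :
    ContinuousOn (fun p => Y p t) N := by
  intro p hp
  have hV₁ : ContDiffOn ℝ 1 V U := hV.of_le one_le_two
  -- `(z, Y)` is itself a trajectory of this `C¹` vector field.
  let W (x : E × (P →L[ℝ] E)) : E × (P →L[ℝ] E) := (V x.1, fderiv ℝ V x.1 ∘L x.2)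
  have hW : ContDiffOn ℝ 1 W (U ×ˢ univ) := by
    refine (hV₁.comp contDiffOn_fst fun x hx => hx.1).prodMk ?_
    exact ((hV.fderiv_of_isOpen hU (by norm_num)).comp contDiffOn_fst
      fun x hx => hx.1).clm_comp contDiffOn_snd
  have hcurve (q : P) (hq : q ∈ N) :
      IsIntegralCurveOn (fun s => (z q s, Y q s)) (fun _ => W) (Icc 0 T) := fun s hs =>
    (hz.isIntegralCurveOn q hq s hs).prodMk ((hY q hq).isIntegralCurveOn s hs)
  obtain ⟨C, -, δ, hδ, hlip⟩ := exists_norm_sub_le_mul (hU.prod isOpen_univ) hW (hcurve p hp)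
    fun s hs => ⟨hz.mapsTo p hp hs, mem_univ _⟩
  have hinit (q : P) (hq : q ∈ N) : ‖(z q 0, Y q 0) - (z p 0, Y p 0)‖ = ‖L (q - p)‖ := by
    rw [Prod.mk_sub_mk, (hY q hq).init, (hY p hp).init, hz.sub_eq q hq p hp, sub_self, Prod.norm_mk,
      norm_zero, max_eq_left (norm_nonneg _)]
  have hlim : Tendsto (fun q => ‖L (q - p)‖) (𝓝[N] p) (𝓝 0) :=
    (Continuous.tendsto' (by fun_prop) _ _ (by simp)).mono_left nhdsWithin_le_nhds
  refine tendsto_iff_norm_sub_tendsto_zero.2 <|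
    squeeze_zero' (Eventually.of_forall fun _ => norm_nonneg _) ?_
      (by rw [← mul_zero C]; exact hlim.const_mul C)
  filter_upwards [hlim.eventually_lt_const hδ, self_mem_nhdsWithin] with q hq hqN
  have hbound := hlip _ (hcurve q hqN) (by rwa [hinit q hqN]) t ht
  rw [hinit q hqN] at hbound
  exact (norm_snd_le _).trans hbound

theorem contDiffOn [CompleteSpace E] (hz : IsTrajectoryFamily V U T L N z) (hU : IsOpen U)
    (hV : ContDiffOn ℝ 2 V U) (hN : IsOpen N) (ht : t ∈ Icc 0 T) :
    ContDiffOn ℝ 1 (fun p => z p t) N := by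
  have hV₁ : ContDiffOn ℝ 1 V U := hV.of_le one_le_two
  have hex (p : P) : ∃ Y, p ∈ N → IsVariationalSolution V T L (z p) Y := by
    by_cases hp : p ∈ N
    · exact (hz.exists_isVariationalSolution hU hV₁ (ht.1.trans ht.2) hp).imp fun _ hY _ => hY
    · exact ⟨0, fun h => absurd h hp⟩
  choose Y hY using hex
  rw [show (1 : WithTop ℕ∞) = 0 + 1 from (zero_add 1).symm,
    contDiffOn_succ_iff_hasFDerivWithinAt_of_uniqueDiffOn hN.uniqueDiffOn]
  exact ⟨by simp, fun p => Y p t,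
    contDiffOn_zero.2 (hz.continuousOn_variationalSolution hU hV hY ht),
    fun p hp => (hz.hasFDerivAt hU hV₁ hN hp (hY p hp) ht).hasFDerivWithinAt⟩

end IsTrajectoryFamily

end SmoothDependence

section SecondOrder

variable {g : ℝ → ℝ → ℝ} {K : ℝ≥0} {x v y w : ℝ → ℝ} {a b : ℝ}

theorem lipschitzWith_firstOrder (hK : ∀ t, LipschitzWith K fun x => g x t) (t : ℝ) :
    LipschitzWith (max 1 K) fun z : ℝ × ℝ => (z.2, -g z.1 t) := by
  have hg := ((hK t).comp (LipschitzWith.prod_fst (α := ℝ) (β := ℝ))).neg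
  rw [mul_one] at hg
  exact LipschitzWith.prod_snd.prodMk hg

theorem eq_of_hasDerivAt (hK : ∀ t, LipschitzWith K fun x => g x t)
    (hx : ∀ t, HasDerivAt x (v t) t) (hv : ∀ t, HasDerivAt v (-g (x t) t) t)
    (hy : ∀ t, HasDerivAt y (w t) t) (hw : ∀ t, HasDerivAt w (-g (y t) t) t) {t₀ : ℝ}
    (h : x t₀ = y t₀) (h' : v t₀ = w t₀) : x = y := by
  have := ODE_solution_unique_univ (v := fun t (z : ℝ × ℝ) => (z.2, -g z.1 t)) (s := fun _ => univ)
    (f := fun t => (x t, v t)) (g := fun t => (y t, w t)) (t₀ := t₀)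
    (fun t => (lipschitzWith_firstOrder hK t).lipschitzOnWith)
    (fun t => ⟨(hx t).prodMk (hv t), mem_univ _⟩) (fun t => ⟨(hy t).prodMk (hw t), mem_univ _⟩)
    (by simp [h, h'])
  exact funext fun t => congrArg Prod.fst (congrFun this t)

theorem IsIVPSolution.hasDerivAt (h : IsIVPSolution g a b x) (t : ℝ) :
    HasDerivAt x (deriv x t) t :=
  (h.differentiable t).hasDerivAt

theorem isIVPSolution_of_hasDerivAt (hx : ∀ t, HasDerivAt x (v t) t)
    (hv : ∀ t, HasDerivAt v (-g (x t) t) t) : IsIVPSolution g (x 0) (v 0) x := by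
  have hderiv : deriv x = v := funext fun t => (hx t).deriv
  exact ⟨fun t => (hx t).differentiableAt, by rwa [hderiv], rfl, by rw [hderiv]⟩

theorem isIVPSolution_ivpSolution (hg : Continuous (uncurry g))
    (hK : ∀ t, LipschitzWith K fun x => g x t) {C : ℝ} (hC : ∀ t, |g 0 t| ≤ C) (a b : ℝ) :
    IsIVPSolution g a b (ivpSolution g a b) := by
  have hfield : Continuous fun p : ℝ × (ℝ × ℝ) => (p.2.2, -uncurry g (p.2.1, p.1)) := by
    fun_prop
  obtain ⟨z, hz₀, hz⟩ := exists_isIntegralCurve_of_lipschitzWith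
    (f := fun t (z : ℝ × ℝ) => (z.2, -g z.1 t)) hfield (lipschitzWith_firstOrder hK) (C := C)
    (fun t => by simpa [Prod.norm_def] using hC t) (a, b)
  have hx (t : ℝ) : HasDerivAt (fun t => (z t).1) (z t).2 t :=
    by exact (hasFDerivAt_fst (𝕜 := ℝ) (p := z t)).comp_hasDerivAt t (hz t)
  have hv (t : ℝ) : HasDerivAt (fun t => (z t).2) (-g (z t).1 t) t :=
    by exact (hasFDerivAt_snd (𝕜 := ℝ) (p := z t)).comp_hasDerivAt t (hz t)
  have hsol := isIVPSolution_of_hasDerivAt hx hv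
  rw [hz₀] at hsol
  exact Classical.epsilon_spec (p := IsIVPSolution g a b) ⟨_, hsol⟩

end SecondOrder

section ImplicitFunction

theorem isInvertible_comp_inr {P : Type*} [NormedAddCommGroup P] [NormedSpace ℝ P]
    {f : P × ℝ → ℝ} {f' : P × ℝ →L[ℝ] ℝ} {d : ℝ} {p : P} {y : ℝ} (hf : HasFDerivAt f f' (p, y))
    (hd : HasDerivAt (fun y => f (p, y)) d y) (hd₀ : d ≠ 0) :
    (f' ∘L .inr ℝ P ℝ).IsInvertible := by
  refine ⟨ContinuousLinearEquiv.unitsEquivAut ℝ (Units.mk0 d hd₀), ?_⟩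
  have hd' : f' (0, 1) = d :=
    (hf.comp_hasDerivAt y ((hasDerivAt_const y p).prodMk (hasDerivAt_id y))).unique hd
  ext
  simp [hd']

end ImplicitFunction

section Kepler

variable {e : ℝ}

theorem kepler_spec (he : |e| < 1) (t : ℝ) : kepler t e - e * Real.sin (kepler t e) = t :=
  (kepler_iff he).1 rfl

theorem kepler_zero (t : ℝ) : kepler t 0 = t :=
  (kepler_iff (by simp)).2 (by simp)

theorem mul_cos_le_abs (e u : ℝ) : e * Real.cos u ≤ |e| :=
  (le_abs_self _).trans <| by
    rw [abs_mul]
    exact mul_le_of_le_one_right (abs_nonneg e) (Real.abs_cos_le_one u)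

theorem contDiffAt_kepler {n : ℕ∞} (hn : n ≠ 0) (he : |e| < 1) (t : ℝ) :
    ContDiffAt ℝ n (fun p : ℝ × ℝ => kepler p.1 p.2) (t, e) := by
  set f : (ℝ × ℝ) × ℝ → ℝ := fun w => w.2 - w.1.2 * Real.sin w.2 - w.1.1
  set w : (ℝ × ℝ) × ℝ := ((t, e), kepler t e)
  have hn' : (n : WithTop ℕ∞) ≠ 0 := mod_cast hn
  have hcd : ContDiffAt ℝ n f w := ContDiff.contDiffAt (by fun_prop)
  have hd : HasDerivAt (fun y => f ((t, e), y)) (1 - e * Real.cos (kepler t e)) (kepler t e) :=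
    ((hasDerivAt_id _).sub ((Real.hasDerivAt_sin _).const_mul e)).sub_const t
  have hinv := isInvertible_comp_inr (hcd.differentiableAt hn').hasFDerivAt hd
    (by linarith [mul_cos_le_abs e (kepler t e)])
  have hfw : f w = 0 := by linarith [kepler_spec he t]
  have he' : ∀ᶠ p : ℝ × ℝ in 𝓝 (t, e), |p.2| < 1 :=
    (continuous_snd.abs.tendsto (t, e)).eventually_lt_const he
  refine (hcd.contDiffAt_implicitFunction hn' hinv).congr_of_eventuallyEq ?_
  filter_upwards [hcd.eventually_apply_implicitFunction hn' hinv, he'] with p hp hpe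
  refine (kepler_iff hpe).2 (sub_eq_zero.1 ?_)
  rwa [hfw] at hp

theorem contDiffAt_radius {n : ℕ∞} (hn : n ≠ 0) (he : |e| < 1) (t : ℝ) :
    ContDiffAt ℝ n (fun p : ℝ × ℝ => radius p.1 p.2) (t, e) :=
  contDiffAt_const.mul
    (contDiffAt_const.sub (contDiffAt_snd.mul (contDiffAt_kepler hn he t).cos))

theorem le_radius (t e : ℝ) : (1 - |e|) / 2 ≤ radius t e := by
  unfold radius
  linarith [mul_cos_le_abs e (kepler t e)]

theorem radius_pos (he : |e| < 1) (t : ℝ) : 0 < radius t e := by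
  linarith [le_radius t e]

theorem radius_zero (t : ℝ) : radius t 0 = 1 / 2 := by simp [radius]

theorem radius_neg (he : |e| < 1) (t : ℝ) : radius (-t) e = radius t e := by
  have : kepler (-t) e = -kepler t e :=
    (kepler_iff he).2 (by rw [Real.sin_neg]; linarith [kepler_spec he t])
  simp [radius, this]

theorem radius_periodic (he : |e| < 1) : Periodic (fun t => radius t e) (2 * Real.pi) := by
  intro t
  have : kepler (t + 2 * Real.pi) e = kepler t e + 2 * Real.pi :=
    (kepler_iff he).2 (by rw [Real.sin_add_two_pi]; linarith [kepler_spec he t])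
  simp [radius, this]

theorem hasDerivAt_radius_zero (t : ℝ) :
    HasDerivAt (fun e => radius t e) (-(1 / 2) * Real.cos t) 0 := by
  have hkepler : DifferentiableAt ℝ (fun e => kepler t e) 0 :=
    ((contDiffAt_kepler one_ne_zero (by simp) t).differentiableAt (by simp)).comp (0 : ℝ)
      (f := fun e : ℝ => (t, e)) (by fun_prop)
  refine (((hasDerivAt_const (0 : ℝ) (1 : ℝ)).sub
    ((hasDerivAt_id (0 : ℝ)).mul hkepler.hasDerivAt.cos)).const_mul (1 / 2 : ℝ)).congr_deriv ?_
  simp [kepler_zero]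

end Kepler

section Force

variable {e : ℝ}

theorem sq_add_radius_sq_pos (he : |e| < 1) (x t : ℝ) : 0 < x ^ 2 + radius t e ^ 2 := by
  have := radius_pos he t
  positivity

theorem F_eq (he : |e| < 1) (x t : ℝ) :
    F x t e = x * (x ^ 2 + radius t e ^ 2) ^ (-(3 / 2) : ℝ) := by
  rw [F, Real.rpow_neg (sq_add_radius_sq_pos he x t).le, div_eq_mul_inv]

/-- The partial derivative `∂F/∂x` of the force term. -/
noncomputable def Fx (x t e : ℝ) : ℝ :=
  (x ^ 2 + radius t e ^ 2) ^ (-(3 / 2) : ℝ) -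
    3 * x ^ 2 * (x ^ 2 + radius t e ^ 2) ^ (-(5 / 2) : ℝ)

theorem hasDerivAt_F (he : |e| < 1) (x t : ℝ) : HasDerivAt (fun x => F x t e) (Fx x t e) x := by
  have hS : HasDerivAt (fun x : ℝ => x ^ 2 + radius t e ^ 2) (2 * x) x := by
    simpa using (hasDerivAt_pow 2 x).add_const (radius t e ^ 2)
  simp_rw [F_eq he]
  refine ((hasDerivAt_id x).mul (hS.rpow_const (p := -(3 / 2))
    (Or.inl (sq_add_radius_sq_pos he x t).ne'))).congr_deriv ?_
  rw [Fx, show (-(3 / 2) - 1 : ℝ) = -(5 / 2) by norm_num]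
  simp only [id]
  ring

theorem deriv_F (he : |e| < 1) (x t : ℝ) : deriv (fun x => F x t e) x = Fx x t e :=
  (hasDerivAt_F he x t).deriv

theorem contDiffAt_sq_add_radius_sq {n : ℕ∞} (hn : n ≠ 0) {w : ℝ × ℝ × ℝ} (he : |w.2.2| < 1) :
    ContDiffAt ℝ n (fun w : ℝ × ℝ × ℝ => w.1 ^ 2 + radius w.2.1 w.2.2 ^ 2) w := by
  have hr : ContDiffAt ℝ n (fun w : ℝ × ℝ × ℝ => radius w.2.1 w.2.2) w :=
    (contDiffAt_radius hn he w.2.1).comp (f := fun w : ℝ × ℝ × ℝ => w.2) w contDiffAt_snd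
  exact (contDiffAt_fst.pow 2).add (hr.pow 2)

theorem contDiffAt_F {n : ℕ∞} (hn : n ≠ 0) {w : ℝ × ℝ × ℝ} (he : |w.2.2| < 1) :
    ContDiffAt ℝ n (fun w : ℝ × ℝ × ℝ => F w.1 w.2.1 w.2.2) w := by
  have hS := sq_add_radius_sq_pos he w.1 w.2.1
  exact contDiffAt_fst.div ((contDiffAt_sq_add_radius_sq hn he).rpow_const_of_ne hS.ne')
    (Real.rpow_pos_of_pos hS _).ne'

theorem contDiffAt_Fx {n : ℕ∞} (hn : n ≠ 0) {w : ℝ × ℝ × ℝ} (he : |w.2.2| < 1) :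
    ContDiffAt ℝ n (fun w : ℝ × ℝ × ℝ => Fx w.1 w.2.1 w.2.2) w := by
  have hS := (sq_add_radius_sq_pos he w.1 w.2.1).ne'
  have hcd := contDiffAt_sq_add_radius_sq hn he
  exact (hcd.rpow_const_of_ne hS).sub
    ((contDiffAt_const.mul (contDiffAt_fst.pow 2)).mul (hcd.rpow_const_of_ne hS))

theorem continuous_F (he : |e| < 1) : Continuous (uncurry fun x t => F x t e) :=
  continuous_iff_continuousAt.2 fun w =>
    (contDiffAt_F one_ne_zero (w := (w.1, w.2, e)) he).continuousAt.comp
      (f := fun w : ℝ × ℝ => (w.1, w.2, e)) (by fun_prop)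

theorem continuous_Fx (he : |e| < 1) : Continuous (uncurry fun x t => Fx x t e) :=
  continuous_iff_continuousAt.2 fun w =>
    (contDiffAt_Fx one_ne_zero (w := (w.1, w.2, e)) he).continuousAt.comp
      (f := fun w : ℝ × ℝ => (w.1, w.2, e)) (by fun_prop)

theorem abs_Fx_le (he : |e| < 1) (x t : ℝ) :
    |Fx x t e| ≤ 2 * (((1 - |e|) / 2) ^ 2) ^ (-(3 / 2) : ℝ) := by
  set S := x ^ 2 + radius t e ^ 2 with hS
  have hS₀ : 0 < S := sq_add_radius_sq_pos he x t
  have hle : S ^ (-(3 / 2) : ℝ) ≤ (((1 - |e|) / 2) ^ 2) ^ (-(3 / 2) : ℝ) := by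
    have hr : 0 < (1 - |e|) / 2 := by linarith
    refine Real.rpow_le_rpow_of_nonpos (by positivity) ?_ (by norm_num)
    nlinarith [pow_le_pow_left₀ hr.le (le_radius t e) 2]
  have hsplit : S ^ (-(3 / 2) : ℝ) = S ^ (-(5 / 2) : ℝ) * S := by
    rw [← Real.rpow_add_one hS₀.ne']; norm_num
  have hx : x ^ 2 * S ^ (-(5 / 2) : ℝ) ≤ S ^ (-(3 / 2) : ℝ) := by
    rw [hsplit, mul_comm]
    gcongr
    linarith [sq_nonneg (radius t e)]
  have hx₀ : 0 ≤ x ^ 2 * S ^ (-(5 / 2) : ℝ) := by positivity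
  rw [Fx, ← hS, abs_le]
  constructor <;> linarith

theorem exists_lipschitzWith_F (he : |e| < 1) : ∃ K : ℝ≥0, ∀ t, LipschitzWith K fun x => F x t e :=
  ⟨_, fun t => lipschitzWith_of_nnnorm_deriv_le
    (fun x => (hasDerivAt_F he x t).differentiableAt) fun x => by
      rw [deriv_F he, ← norm_toNNReal]
      exact Real.toNNReal_mono (abs_Fx_le he x t)⟩

end Force

section Solution

variable {e : ℝ}

theorem isIVPSolution_X (he : |e| < 1) (ξ : ℝ) :
    IsIVPSolution (fun x s => F x s e) ξ 0 fun t => X t ξ e := by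
  obtain ⟨K, hK⟩ := exists_lipschitzWith_F he
  exact isIVPSolution_ivpSolution (continuous_F he) hK (C := 0) (fun t => by simp [F]) ξ 0

/-- The velocity `Ẋ(t, ξ, e)` of the solution `X(t, ξ, e)`. -/
noncomputable def XDot (t ξ e : ℝ) : ℝ := deriv (fun s => X s ξ e) t

theorem hasDerivAt_X (he : |e| < 1) (t ξ : ℝ) : HasDerivAt (fun s => X s ξ e) (XDot t ξ e) t :=
  (isIVPSolution_X he ξ).hasDerivAt t

theorem hasDerivAt_XDot (he : |e| < 1) (t ξ : ℝ) :
    HasDerivAt (fun s => XDot s ξ e) (-F (X t ξ e) t e) t :=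
  (isIVPSolution_X he ξ).ode t

theorem continuous_X (he : |e| < 1) (ξ : ℝ) : Continuous fun t => X t ξ e :=
  (isIVPSolution_X he ξ).differentiable.continuous

theorem X_init (he : |e| < 1) (ξ : ℝ) : X 0 ξ e = ξ := (isIVPSolution_X he ξ).init

theorem XDot_init (he : |e| < 1) (ξ : ℝ) : XDot 0 ξ e = 0 :=
  (isIVPSolution_X he ξ).init_deriv

theorem eq_X_of_hasDerivAt (he : |e| < 1) {ξ t₀ : ℝ} {y w : ℝ → ℝ}
    (hy : ∀ t, HasDerivAt y (w t) t) (hw : ∀ t, HasDerivAt w (-F (y t) t e) t)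
    (h : y t₀ = X t₀ ξ e) (h' : w t₀ = XDot t₀ ξ e) : y = fun t => X t ξ e := by
  obtain ⟨K, hK⟩ := exists_lipschitzWith_F he
  exact eq_of_hasDerivAt hK hy hw (fun t => hasDerivAt_X he t ξ) (fun t => hasDerivAt_XDot he t ξ)
    h h'

theorem hasDerivAt_comp_neg {y : ℝ → ℝ} {d t : ℝ} (h : HasDerivAt y d (-t)) :
    HasDerivAt (fun s => y (-s)) (-d) t :=
  (h.comp t (hasDerivAt_neg t)).congr_deriv (mul_neg_one d)

theorem X_even (he : |e| < 1) (ξ : ℝ) : Function.Even fun t => X t ξ e := by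
  refine congrFun (eq_X_of_hasDerivAt he (t₀ := 0)
    (fun t => hasDerivAt_comp_neg (hasDerivAt_X he (-t) ξ))
    (fun t => (hasDerivAt_comp_neg (hasDerivAt_XDot he (-t) ξ)).neg.congr_deriv ?_)
    (by simp) (by simp [XDot_init he]))
  simp [F, radius_neg he]

theorem XDot_odd (he : |e| < 1) (ξ : ℝ) : Function.Odd fun t => XDot t ξ e := by
  intro t
  simp only [XDot]
  rw [← neg_eq_iff_eq_neg, ← deriv_comp_neg]
  exact congrFun (congrArg deriv (funext (X_even he ξ))) t

theorem X_periodic (he : |e| < 1) {ξ : ℝ} {m : ℕ} (h : XDot (m * Real.pi) ξ e = 0) :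
    Periodic (fun t => X t ξ e) (m * (2 * Real.pi)) := by
  have hsum : -(m * Real.pi) + m * (2 * Real.pi) = m * Real.pi := by ring
  refine congrFun (eq_X_of_hasDerivAt he (t₀ := -(m * Real.pi))
    (fun t => (hasDerivAt_X he _ ξ).comp_add_const t _)
    (fun t => ((hasDerivAt_XDot he _ ξ).comp_add_const t _).congr_deriv ?_) ?_ ?_)
  · simp only [F, ((radius_periodic he).nat_mul m) t]
  · rw [hsum]
    exact (X_even he ξ _).symm
  · rw [hsum, h]
    exact (neg_eq_zero.1 ((XDot_odd he ξ (-(m * Real.pi))).symm.trans (by simpa using h))).symm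

theorem XDot_periodic (he : |e| < 1) {ξ : ℝ} {m : ℕ} (h : XDot (m * Real.pi) ξ e = 0) :
    Periodic (fun t => XDot t ξ e) (m * (2 * Real.pi)) := by
  intro t
  simp only [XDot]
  rw [← deriv_comp_add_const]
  exact congrFun (congrArg deriv (funext (X_periodic he h))) t

end Solution

section HillEquation

/-- `y`, with velocity `v`, solves the inhomogeneous Hill equation `ÿ + q(t) y = f(t)` on `S`.
The derivatives are taken within `S`, so that compact time intervals are allowed. -/
structure IsHillSolutionOn (q f y v : ℝ → ℝ) (S : Set ℝ) : Prop where
  hasDerivWithinAt : ∀ t ∈ S, HasDerivWithinAt y (v t) S t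
  hasDerivWithinAt_velocity : ∀ t ∈ S, HasDerivWithinAt v (f t - q t * y t) S t

namespace IsHillSolutionOn

variable {q f y v f₁ f₂ y₁ y₂ v₁ v₂ : ℝ → ℝ} {S S' : Set ℝ} {a b : ℝ}

theorem of_hasDerivAt (hy : ∀ t, HasDerivAt y (v t) t)
    (hv : ∀ t, HasDerivAt v (f t - q t * y t) t) : IsHillSolutionOn q f y v S :=
  ⟨fun t _ => (hy t).hasDerivWithinAt, fun t _ => (hv t).hasDerivWithinAt⟩

theorem continuousOn (h : IsHillSolutionOn q f y v S) : ContinuousOn y S :=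
  HasDerivWithinAt.continuousOn h.hasDerivWithinAt

theorem continuousOn_velocity (h : IsHillSolutionOn q f y v S) : ContinuousOn v S :=
  HasDerivWithinAt.continuousOn h.hasDerivWithinAt_velocity

theorem add_smul (h₁ : IsHillSolutionOn q f₁ y₁ v₁ S) (h₂ : IsHillSolutionOn q f₂ y₂ v₂ S)
    (c : ℝ) : IsHillSolutionOn q (f₁ + c • f₂) (y₁ + c • y₂) (v₁ + c • v₂) S := by
  refine ⟨fun t ht => (h₁.hasDerivWithinAt t ht).add ((h₂.hasDerivWithinAt t ht).const_smul c),
    fun t ht => ((h₁.hasDerivWithinAt_velocity t ht).add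
      ((h₂.hasDerivWithinAt_velocity t ht).const_smul c)).congr_deriv ?_⟩
  simp only [Pi.add_apply, Pi.smul_apply, smul_eq_mul]
  ring

/-- Green's identity. -/
theorem integral_eq_wronskian_sub (h₁ : IsHillSolutionOn q f₁ y₁ v₁ (Icc a b))
    (h₂ : IsHillSolutionOn q f₂ y₂ v₂ (Icc a b)) (hab : a ≤ b) (hf₁ : ContinuousOn f₁ (Icc a b))
    (hf₂ : ContinuousOn f₂ (Icc a b)) :
    ∫ t in a..b, (f₁ t * y₂ t - y₁ t * f₂ t) =
      (v₁ b * y₂ b - y₁ b * v₂ b) - (v₁ a * y₂ a - y₁ a * v₂ a) := by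
  refine intervalIntegral.integral_eq_sub_of_hasDerivAt_of_le hab
    ((h₁.continuousOn_velocity.mul h₂.continuousOn).sub
      (h₁.continuousOn.mul h₂.continuousOn_velocity)) (fun t ht => ?_)
    (((hf₁.mul h₂.continuousOn).sub (h₁.continuousOn.mul hf₂)).intervalIntegrable_of_Icc hab)
  have htI := Ioo_subset_Icc_self ht
  refine ((((h₁.hasDerivWithinAt_velocity t htI).mul (h₂.hasDerivWithinAt t htI)).sub
    ((h₁.hasDerivWithinAt t htI).mul (h₂.hasDerivWithinAt_velocity t htI))).hasDerivAt
      (Icc_mem_nhds ht.1 ht.2)).congr_deriv ?_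
  ring

end IsHillSolutionOn

end HillEquation

section CircularProblem

variable {ξ s t : ℝ}

theorem abs_zero_lt_one : |(0 : ℝ)| < 1 := by simp

theorem F_zero (x t : ℝ) : F x t 0 = x * (x ^ 2 + 1 / 4) ^ (-(3 / 2) : ℝ) := by
  rw [F_eq abs_zero_lt_one, radius_zero]
  norm_num

theorem Fx_zero (x t : ℝ) : Fx x t 0 = (x ^ 2 + 1 / 4) ^ (-(3 / 2) : ℝ) -
    3 * x ^ 2 * (x ^ 2 + 1 / 4) ^ (-(5 / 2) : ℝ) := by
  rw [Fx, radius_zero]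
  norm_num

theorem continuous_sq_add_rpow (r : ℝ) : Continuous fun x : ℝ => (x ^ 2 + 1 / 4) ^ r :=
  Continuous.rpow_const (by fun_prop) fun _ => Or.inl (by positivity)

theorem F_zero_pos {x : ℝ} (hx : 0 < x) (t : ℝ) : 0 < F x t 0 := by
  rw [F_zero]
  positivity

theorem F_zero_le_four (x t : ℝ) : F x t 0 ≤ 4 := by
  have hS : 0 < x ^ 2 + 1 / 4 := by positivity
  have hx : x ≤ (x ^ 2 + 1 / 4) ^ (1 / 2 : ℝ) := by
    rw [← Real.sqrt_eq_rpow]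
    exact Real.le_sqrt_of_sq_le (by linarith)
  calc F x t 0 = x * (x ^ 2 + 1 / 4) ^ (-(3 / 2) : ℝ) := F_zero x t
    _ ≤ (x ^ 2 + 1 / 4) ^ (1 / 2 : ℝ) * (x ^ 2 + 1 / 4) ^ (-(3 / 2) : ℝ) := by gcongr
    _ = (x ^ 2 + 1 / 4)⁻¹ := by rw [← Real.rpow_add hS, ← Real.rpow_neg_one]; norm_num
    _ ≤ (1 / 4 : ℝ)⁻¹ := by gcongr; linarith [sq_nonneg x]
    _ = 4 := by norm_num

theorem hasDerivAt_X_zero (t ξ : ℝ) : HasDerivAt (fun s => X s ξ 0) (XDot t ξ 0) t :=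
  hasDerivAt_X abs_zero_lt_one t ξ

theorem hasDerivAt_XDot_zero (t ξ : ℝ) : HasDerivAt (fun s => XDot s ξ 0) (-F (X t ξ 0) t 0) t :=
  hasDerivAt_XDot abs_zero_lt_one t ξ

theorem continuous_X_zero (ξ : ℝ) : Continuous fun t => X t ξ 0 :=
  continuous_X abs_zero_lt_one ξ

theorem X_zero_init (ξ : ℝ) : X 0 ξ 0 = ξ := X_init abs_zero_lt_one ξ

theorem XDot_zero_init (ξ : ℝ) : XDot 0 ξ 0 = 0 := XDot_init abs_zero_lt_one ξ

theorem XDot_zero_neg (h : ∀ t ∈ Ioo 0 s, 0 < X t ξ 0) (ht : t ∈ Ioc 0 s) : XDot t ξ 0 < 0 := by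
  have hanti : StrictAntiOn (fun t => XDot t ξ 0) (Icc 0 s) := by
    refine strictAntiOn_of_deriv_neg (convex_Icc 0 s)
      (HasDerivAt.continuousOn fun t _ => hasDerivAt_XDot_zero t ξ) fun t ht => ?_
    rw [interior_Icc] at ht
    rw [(hasDerivAt_XDot_zero t ξ).deriv, neg_lt_zero]
    exact F_zero_pos (h t ht) t
  simpa [XDot_zero_init] using
    hanti ⟨le_rfl, ht.1.le.trans ht.2⟩ (Ioc_subset_Icc_self ht) ht.1

theorem X_zero_strictAntiOn (h : ∀ t ∈ Ioo 0 s, 0 < X t ξ 0) :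
    StrictAntiOn (fun t => X t ξ 0) (Icc 0 s) := by
  refine strictAntiOn_of_deriv_neg (convex_Icc 0 s) (continuous_X_zero ξ).continuousOn
    fun t ht => ?_
  rw [interior_Icc] at ht
  rw [(hasDerivAt_X_zero t ξ).deriv]
  exact XDot_zero_neg h (Ioo_subset_Ioc_self ht)

theorem X_two_mul_sub (h : X s ξ 0 = 0) (t : ℝ) : X (2 * s - t) ξ 0 = -X t ξ 0 := by
  have hs : 2 * s - s = s := by ring
  rw [← neg_eq_iff_eq_neg]
  refine congrFun (eq_X_of_hasDerivAt abs_zero_lt_one (t₀ := s)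
    (y := fun t => -X (2 * s - t) ξ 0) (w := fun t => XDot (2 * s - t) ξ 0)
    (fun t => ?_) (fun t => ?_) (by simp only [hs, h, neg_zero]) (by simp only [hs])) t
  · exact ((hasDerivAt_X_zero (2 * s - t) ξ).comp_const_sub (2 * s) t).neg.congr_deriv
      (neg_neg _)
  · refine ((hasDerivAt_XDot_zero (2 * s - t) ξ).comp_const_sub (2 * s) t).congr_deriv ?_
    simp [F_zero]

theorem X_zero_antiperiodic (h : X s ξ 0 = 0) : Antiperiodic (fun t => X t ξ 0) (2 * s) := by
  intro t
  rw [← X_even abs_zero_lt_one ξ t, ← X_two_mul_sub h, sub_neg_eq_add, add_comm]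

theorem XDot_zero_antiperiodic (h : X s ξ 0 = 0) :
    Antiperiodic (fun t => XDot t ξ 0) (2 * s) := by
  intro t
  have hshift : (fun t => X (t + 2 * s) ξ 0) = -fun t => X t ξ 0 :=
    funext (X_zero_antiperiodic h)
  exact ((hasDerivAt_X_zero (t + 2 * s) ξ).comp_add_const t (2 * s)).unique
    (hshift ▸ (hasDerivAt_X_zero t ξ).neg)

/-- `s` is the first positive zero of the solution of the circular problem that starts at rest
from `ξ`. -/
structure IsQuarterPeriod (ξ s : ℝ) : Prop where
  pos : 0 < s
  eq_zero : X s ξ 0 = 0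
  pos_of_mem : ∀ t ∈ Ico 0 s, 0 < X t ξ 0

namespace IsQuarterPeriod

theorem start_pos (h : IsQuarterPeriod ξ s) : 0 < ξ := by
  simpa [X_zero_init] using h.pos_of_mem 0 ⟨le_rfl, h.pos⟩

theorem pos_of_mem_Ioo (h : IsQuarterPeriod ξ s) : ∀ t ∈ Ioo 0 s, 0 < X t ξ 0 :=
  fun t ht => h.pos_of_mem t (Ioo_subset_Ico_self ht)

theorem XDot_neg (h : IsQuarterPeriod ξ s) : XDot s ξ 0 < 0 :=
  XDot_zero_neg h.pos_of_mem_Ioo ⟨h.pos, le_rfl⟩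

theorem X_periodic (h : IsQuarterPeriod ξ s) : Periodic (fun t => X t ξ 0) (4 * s) := by
  have := (X_zero_antiperiodic h.eq_zero).periodic_two_mul
  rwa [← mul_assoc, show (2 : ℝ) * 2 = 4 by norm_num] at this

theorem X_lt_start_of_le_two_mul (h : IsQuarterPeriod ξ s) (ht : 0 < t) (hts : t ≤ 2 * s) :
    X t ξ 0 < ξ := by
  have hanti := X_zero_strictAntiOn h.pos_of_mem_Ioo
  have hs := h.pos
  rcases le_total t s with h' | h'
  · simpa [X_zero_init] using hanti ⟨le_rfl, hs.le⟩ ⟨ht.le, h'⟩ ht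
  · have hle : X s ξ 0 ≤ X (2 * s - t) ξ 0 :=
      hanti.antitoneOn ⟨by linarith, by linarith⟩ ⟨hs.le, le_rfl⟩ (by linarith)
    rw [h.eq_zero, X_two_mul_sub h.eq_zero] at hle
    linarith [h.start_pos]

theorem X_lt_start (h : IsQuarterPeriod ξ s) (ht : 0 < t) (hts : t < 4 * s) : X t ξ 0 < ξ := by
  rcases le_total t (2 * s) with h' | h'
  · exact h.X_lt_start_of_le_two_mul ht h'
  · have heq := h.X_periodic (-t)
    simp only [X_even abs_zero_lt_one ξ t] at heq
    rw [← heq]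
    exact h.X_lt_start_of_le_two_mul (by linarith) (by linarith)

theorem hasMinimalPeriod (h : IsQuarterPeriod ξ s) :
    HasMinimalPeriod (fun t => X t ξ 0) (4 * s) := by
  refine ⟨⟨by linarith [h.pos], h.X_periodic⟩, fun S ⟨hS₀, hS⟩ => ?_⟩
  by_contra! hlt
  have hS' : X S ξ 0 = ξ := by simpa [X_zero_init] using hS 0
  exact (h.X_lt_start hS₀ hlt).ne hS'

end IsQuarterPeriod

theorem exists_isQuarterPeriod_of_nonpos (hξ : 0 < ξ) (ht : 0 ≤ t) (hX : X t ξ 0 ≤ 0) :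
    ∃ s ≤ t, IsQuarterPeriod ξ s := by
  have hzero {r : ℝ} (hr : 0 ≤ r) (hXr : X r ξ 0 ≤ 0) : ∃ z ∈ Icc 0 r, X z ξ 0 = 0 :=
    intermediate_value_Icc' hr (continuous_X_zero ξ).continuousOn
      ⟨hXr, (X_zero_init ξ).symm ▸ hξ.le⟩
  have hcompact : IsCompact (Icc 0 t ∩ {r | X r ξ 0 = 0}) :=
    isCompact_Icc.inter_right (isClosed_eq (continuous_X_zero ξ) continuous_const)
  obtain ⟨s, ⟨hs, hXs⟩, hleast⟩ := hcompact.exists_isLeast (hzero ht hX)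
  refine ⟨s, hs.2, hs.1.lt_of_ne ?_, hXs, fun r hr => ?_⟩
  · rintro rfl
    exact hξ.ne' ((X_zero_init ξ).symm.trans hXs)
  · by_contra! hXr
    obtain ⟨z, hz, hXz⟩ := hzero hr.1 hXr
    exact hr.2.not_ge ((hleast ⟨⟨hz.1, hz.2.trans (hr.2.le.trans hs.2)⟩, hXz⟩).trans hz.2)

theorem isQuarterPeriod_of_hasMinimalPeriod {T : ℝ} (hξ : 0 < ξ)
    (hT : HasMinimalPeriod (fun t => X t ξ 0) T) : IsQuarterPeriod ξ (T / 4) := by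
  obtain ⟨hT₀, hper⟩ := hT.1
  obtain ⟨t, ht, hXt⟩ : ∃ t ∈ Ioo 0 T, X t ξ 0 ≤ 0 := by
    by_contra! hpos
    have hlt : X T ξ 0 < X 0 ξ 0 :=
      X_zero_strictAntiOn hpos (left_mem_Icc.2 hT₀.le) (right_mem_Icc.2 hT₀.le) hT₀
    exact hlt.ne (by simpa using hper 0)
  obtain ⟨s, -, hs⟩ := exists_isQuarterPeriod_of_nonpos hξ ht.1.le hXt
  rwa [hT.unique hs.hasMinimalPeriod, mul_div_cancel_left₀ _ four_ne_zero]

end CircularProblem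

section QuarterPeriodExistence

variable {ξ s t e : ℝ}

theorem exists_lipschitzWith_X (he : |e| < 1) (s : ℝ) :
    ∃ C, ∀ t ∈ Icc 0 s, LipschitzWith C fun ξ => X t ξ e := by
  obtain ⟨K, hK⟩ := exists_lipschitzWith_F he
  have hz (ξ t : ℝ) : HasDerivAt (fun t => (X t ξ e, XDot t ξ e))
      (XDot t ξ e, -F (X t ξ e) t e) t :=
    (hasDerivAt_X he t ξ).prodMk (hasDerivAt_XDot he t ξ)
  refine ⟨⟨_, (Real.exp_pos ((max 1 K : ℝ≥0) * s)).le⟩, fun t ht =>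
    LipschitzWith.of_dist_le_mul fun ξ ξ' => ?_⟩
  have hle := dist_le_of_trajectories_ODE (a := 0) (b := s) (δ := dist ξ ξ')
    (fun t => lipschitzWith_firstOrder hK t)
    (HasDerivAt.continuousOn fun t _ => hz ξ t) (fun t _ => (hz ξ t).hasDerivWithinAt)
    (HasDerivAt.continuousOn fun t _ => hz ξ' t) (fun t _ => (hz ξ' t).hasDerivWithinAt)
    (by simp [Prod.dist_eq, X_init he, XDot_init he]) t ht
  calc dist (X t ξ e) (X t ξ' e)
      ≤ dist ξ ξ' * Real.exp ((max 1 K : ℝ≥0) * (t - 0)) := (le_max_left _ _).trans hle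
    _ ≤ Real.exp ((max 1 K : ℝ≥0) * s) * dist ξ ξ' := by
      rw [mul_comm, sub_zero]
      gcongr
      exact ht.2

theorem continuous_sInf_image_X (he : |e| < 1) (s : ℝ) :
    Continuous fun ξ => sInf ((fun t => X t ξ e) '' Icc 0 s) := by
  obtain ⟨C, hC⟩ := exists_lipschitzWith_X he s
  have hX : Continuous fun w : ℝ × Icc 0 s => X w.2 w.1 e :=
    continuous_prod_of_continuous_lipschitzWith _ C
      (fun ξ => (continuous_X he ξ).comp continuous_subtype_val) fun t => hC t t.2
  have hinf := isCompact_univ.continuous_sInf (f := fun ξ (t : Icc 0 s) => X t ξ e) hX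
  rw [funext fun ξ => congrArg sInf image_univ] at hinf
  simpa only [image_eq_range] using hinf

theorem sub_four_mul_sq_le_X (ξ : ℝ) (ht : 0 ≤ t) : ξ - 4 * t ^ 2 ≤ X t ξ 0 := by
  have hXDot {r : ℝ} (hr : 0 ≤ r) : -4 * r ≤ XDot r ξ 0 := by
    have := (convex_Icc 0 r).mul_sub_le_image_sub_of_le_deriv
      (HasDerivAt.continuousOn fun t _ => hasDerivAt_XDot_zero t ξ)
      (fun t _ => (hasDerivAt_XDot_zero t ξ).differentiableAt.differentiableWithinAt)
      (C := -4) (fun t _ => by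
        rw [(hasDerivAt_XDot_zero t ξ).deriv]
        linarith [F_zero_le_four (X t ξ 0) t]) 0 (left_mem_Icc.2 hr) r (right_mem_Icc.2 hr) hr
    simpa [XDot_zero_init] using this
  have := (convex_Icc 0 t).mul_sub_le_image_sub_of_le_deriv (continuous_X_zero ξ).continuousOn
    (fun t _ => (hasDerivAt_X_zero t ξ).differentiableAt.differentiableWithinAt)
    (C := -4 * t) (fun r hr => by
      rw [interior_Icc] at hr
      rw [(hasDerivAt_X_zero r ξ).deriv]
      linarith [hXDot hr.1.le, hr.2]) 0 (left_mem_Icc.2 ht) t (right_mem_Icc.2 ht) ht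
  rw [X_zero_init] at this
  linarith

theorem isHillSolutionOn_X_of_const (ξ ω : ℝ) (S : Set ℝ) :
    IsHillSolutionOn (fun _ => ω ^ 2)
      (fun t => (ω ^ 2 - (X t ξ 0 ^ 2 + 1 / 4) ^ (-(3 / 2) : ℝ)) * X t ξ 0)
      (fun t => X t ξ 0) (fun t => XDot t ξ 0) S := by
  refine .of_hasDerivAt (hasDerivAt_X_zero · ξ) fun t =>
    (hasDerivAt_XDot_zero t ξ).congr_deriv ?_
  rw [F_zero]
  ring

theorem isHillSolutionOn_cos (ω : ℝ) (S : Set ℝ) :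
    IsHillSolutionOn (fun _ => ω ^ 2) 0 (fun t => Real.cos (ω * t))
      (fun t => -Real.sin (ω * t) * ω) S := by
  have hlin (t : ℝ) : HasDerivAt (fun t => ω * t) ω t := by
    simpa using (hasDerivAt_id t).const_mul ω
  refine .of_hasDerivAt (fun t => (hlin t).cos) fun t =>
    ((hlin t).sin.neg.mul_const ω).congr_deriv ?_
  simp only [Pi.zero_apply]
  ring

theorem exists_X_nonpos_of_le (hs : 0 < s)
    (h : (Real.pi / (2 * s)) ^ 2 ≤ (ξ ^ 2 + 1 / 4) ^ (-(3 / 2) : ℝ)) :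
    ∃ t ∈ Icc 0 s, X t ξ 0 ≤ 0 := by
  set ω := Real.pi / (2 * s) with hω
  have hω₀ : 0 < ω := by positivity
  have hωs : ω * s = Real.pi / 2 := by rw [hω]; field_simp
  by_contra! hpos
  have hX {t : ℝ} (ht : t ∈ Icc 0 s) : X t ξ 0 ≤ ξ := by
    have := (X_zero_strictAntiOn fun t ht => hpos t (Ioo_subset_Icc_self ht)).antitoneOn
      (left_mem_Icc.2 hs.le) ht ht.1
    simpa [X_zero_init] using this
  have hXc := continuous_X_zero ξ
  have hgreen := (isHillSolutionOn_X_of_const ξ ω (Icc 0 s)).integral_eq_wronskian_sub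
    (isHillSolutionOn_cos ω _) hs.le
    ((continuous_const.sub ((continuous_sq_add_rpow _).comp hXc)).mul hXc).continuousOn
    continuousOn_const
  simp only [hωs, Real.cos_pi_div_two, Real.sin_pi_div_two, XDot_zero_init, mul_zero,
    Real.sin_zero, Pi.zero_apply] at hgreen
  have hle : ∫ t in (0 : ℝ)..s, ((ω ^ 2 - (X t ξ 0 ^ 2 + 1 / 4) ^ (-(3 / 2) : ℝ)) * X t ξ 0 *
      Real.cos (ω * t) - 0) ≤ 0 := by
    rw [intervalIntegral.integral_of_le hs.le]
    refine MeasureTheory.setIntegral_nonpos measurableSet_Ioc fun t ht => ?_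
    replace ht := Ioc_subset_Icc_self ht
    have hcos : 0 ≤ Real.cos (ω * t) := by
      refine Real.cos_nonneg_of_neg_pi_div_two_le_of_le ?_ (hωs ▸ by gcongr; exact ht.2)
      linarith [mul_nonneg hω₀.le ht.1, Real.pi_pos]
    have hrpow : (ξ ^ 2 + 1 / 4) ^ (-(3 / 2) : ℝ) ≤ (X t ξ 0 ^ 2 + 1 / 4) ^ (-(3 / 2) : ℝ) :=
      Real.rpow_le_rpow_of_nonpos (by positivity)
        (by gcongr; exacts [(hpos t ht).le, hX ht]) (by norm_num)
    rw [sub_zero]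
    exact mul_nonpos_of_nonpos_of_nonneg
      (mul_nonpos_of_nonpos_of_nonneg (by linarith) (hpos t ht).le) hcos
  nlinarith [hpos s (right_mem_Icc.2 hs.le)]

theorem exists_X_nonpos (hs : 0 < s) (h : (Real.pi / (2 * s)) ^ 2 < 8) :
    ∃ ξ > 0, ∃ t ∈ Icc 0 s, X t ξ 0 ≤ 0 := by
  have height : ((0 : ℝ) ^ 2 + 1 / 4) ^ (-(3 / 2) : ℝ) = 8 := by
    rw [show (0 : ℝ) ^ 2 + 1 / 4 = 2 ^ (-2 : ℝ) by rw [Real.rpow_neg zero_le_two]; norm_num,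
      ← Real.rpow_mul zero_le_two]
    norm_num
  have hev : ∀ᶠ ξ in 𝓝[>] (0 : ℝ),
      (Real.pi / (2 * s)) ^ 2 < (ξ ^ 2 + 1 / 4) ^ (-(3 / 2) : ℝ) :=
    ((continuous_sq_add_rpow _).continuousAt.mono_left
      nhdsWithin_le_nhds).eventually_const_lt (h.trans_eq height.symm)
  obtain ⟨ξ, hξ, hξ₀⟩ := (hev.and self_mem_nhdsWithin).exists
  exact ⟨ξ, hξ₀, exists_X_nonpos_of_le hs hξ.le⟩

theorem exists_isQuarterPeriod (hs : 0 < s) (h : (Real.pi / (2 * s)) ^ 2 < 8) :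
    ∃ ξ, IsQuarterPeriod ξ s := by
  set μ : ℝ → ℝ := fun ξ => sInf ((fun t => X t ξ 0) '' Icc 0 s)
  have hμ (ξ : ℝ) : ∃ t ∈ Icc 0 s, μ ξ = X t ξ 0 ∧ ∀ r ∈ Icc 0 s, X t ξ 0 ≤ X r ξ 0 :=
    isCompact_Icc.exists_sInf_image_eq_and_le (nonempty_Icc.2 hs.le)
      (continuous_X_zero ξ).continuousOn
  obtain ⟨ξ₁, hξ₁, t₁, ht₁, hX₁⟩ := exists_X_nonpos hs h
  have hμ₁ : μ ξ₁ ≤ 0 := by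
    obtain ⟨t, -, hμt, hle⟩ := hμ ξ₁
    exact hμt.trans_le ((hle t₁ ht₁).trans hX₁)
  have hμ₂ : 0 ≤ μ (ξ₁ + 4 * s ^ 2) := by
    obtain ⟨t, ht, hμt, -⟩ := hμ (ξ₁ + 4 * s ^ 2)
    rw [hμt]
    linarith [sub_four_mul_sq_le_X (ξ₁ + 4 * s ^ 2) ht.1, pow_le_pow_left₀ ht.1 ht.2 2]
  obtain ⟨ξ, hξ, hμξ⟩ := intermediate_value_Icc (by linarith [sq_nonneg s])
    (continuous_sInf_image_X abs_zero_lt_one s).continuousOn ⟨hμ₁, hμ₂⟩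
  obtain ⟨t, ht, hμt, hmin⟩ := hμ ξ
  have hXt : X t ξ 0 = 0 := hμt.symm.trans hμξ
  obtain ⟨r, hrt, hr⟩ := exists_isQuarterPeriod_of_nonpos (hξ₁.trans_le hξ.1) ht.1 hXt.le
  rcases (hrt.trans ht.2).eq_or_lt with rfl | hrs
  · exact ⟨ξ, hr⟩
  · have hlocal : IsLocalMin (fun t => X t ξ 0) r := by
      filter_upwards [Icc_mem_nhds hr.pos hrs] with z hz
      exact (hr.eq_zero.trans hXt.symm).trans_le (hmin z hz)
    exact absurd (hlocal.hasDerivAt_eq_zero (hasDerivAt_X_zero r ξ)) hr.XDot_neg.ne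

end QuarterPeriodExistence

section LinearizedEquation

theorem lipschitzWith_mul_of_abs_le {q : ℝ → ℝ} {C : ℝ} (hC : ∀ t, |q t| ≤ C) (t : ℝ) :
    LipschitzWith C.toNNReal fun y : ℝ => q t * y := by
  refine LipschitzWith.of_dist_le_mul fun x y => ?_
  rw [Real.coe_toNNReal _ ((abs_nonneg _).trans (hC t)), Real.dist_eq, Real.dist_eq, ← mul_sub,
    abs_mul]
  gcongr
  exact hC t

/-- The coefficient of the linearization of the Sitnikov equation along `X(·, ξ, e)`. -/
noncomputable def hillCoeff (ξ e t : ℝ) : ℝ := Fx (X t ξ e) t e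

/-- The solution with initial data `(a, b)` of the linearization along `X(·, ξ, e)`; the
fundamental solutions `ψ₁`, `ψ₂` are `hillSol 1 0 ξ e` and `hillSol 0 1 ξ e`. -/
noncomputable def hillSol (a b ξ e : ℝ) : ℝ → ℝ :=
  ivpSolution (fun y t => hillCoeff ξ e t * y) a b

/-- The velocity of `hillSol`. -/
noncomputable def hillVel (a b ξ e : ℝ) : ℝ → ℝ := deriv (hillSol a b ξ e)

variable {e : ℝ}

theorem continuous_hillCoeff (he : |e| < 1) (ξ : ℝ) : Continuous (hillCoeff ξ e) :=
  (continuous_Fx he).comp ((continuous_X he ξ).prodMk continuous_id)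

theorem abs_hillCoeff_le (he : |e| < 1) (ξ t : ℝ) :
    |hillCoeff ξ e t| ≤ 2 * (((1 - |e|) / 2) ^ 2) ^ (-(3 / 2) : ℝ) := abs_Fx_le he _ _

theorem isIVPSolution_hillSol (he : |e| < 1) (a b ξ : ℝ) :
    IsIVPSolution (fun y t => hillCoeff ξ e t * y) a b (hillSol a b ξ e) :=
  isIVPSolution_ivpSolution (g := fun y t => hillCoeff ξ e t * y)
    (((continuous_hillCoeff he ξ).comp continuous_snd).mul continuous_fst)
    (lipschitzWith_mul_of_abs_le (abs_hillCoeff_le he ξ)) (C := 0) (fun t => by simp) a b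

theorem hasDerivAt_hillSol (he : |e| < 1) (a b ξ t : ℝ) :
    HasDerivAt (hillSol a b ξ e) (hillVel a b ξ e t) t :=
  (isIVPSolution_hillSol he a b ξ).hasDerivAt t

theorem hasDerivAt_hillVel (he : |e| < 1) (a b ξ t : ℝ) :
    HasDerivAt (hillVel a b ξ e) (-(hillCoeff ξ e t * hillSol a b ξ e t)) t :=
  (isIVPSolution_hillSol he a b ξ).ode t

theorem hillSol_init (he : |e| < 1) (a b ξ : ℝ) : hillSol a b ξ e 0 = a :=
  (isIVPSolution_hillSol he a b ξ).init

theorem hillVel_init (he : |e| < 1) (a b ξ : ℝ) : hillVel a b ξ e 0 = b :=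
  (isIVPSolution_hillSol he a b ξ).init_deriv

theorem isHillSolutionOn_hillSol (he : |e| < 1) (a b ξ : ℝ) (S : Set ℝ) :
    IsHillSolutionOn (hillCoeff ξ e) 0 (hillSol a b ξ e) (hillVel a b ξ e) S :=
  .of_hasDerivAt (hasDerivAt_hillSol he a b ξ) fun t =>
    (hasDerivAt_hillVel he a b ξ t).congr_deriv (zero_sub _).symm

theorem IsHillSolutionOn.eq_zero_of_abs_le {q y v : ℝ → ℝ} {C t₀ : ℝ} (hq : ∀ t, |q t| ≤ C)
    (h : IsHillSolutionOn q 0 y v univ) (hy₀ : y t₀ = 0) (hv₀ : v t₀ = 0) : y = 0 ∧ v = 0 := by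
  have hy (t : ℝ) : HasDerivAt y (v t) t :=
    (h.hasDerivWithinAt t (mem_univ t)).hasDerivAt univ_mem
  have hv (t : ℝ) : HasDerivAt v (-(q t * y t)) t :=
    ((h.hasDerivWithinAt_velocity t (mem_univ t)).hasDerivAt univ_mem).congr_deriv (zero_sub _)
  have hzero : y = fun _ => 0 :=
    eq_of_hasDerivAt (w := fun _ => 0) (lipschitzWith_mul_of_abs_le hq) hy hv
      (fun t => hasDerivAt_const t 0) (fun t => by simpa using hasDerivAt_const t (0 : ℝ)) hy₀ hv₀
  exact ⟨hzero, funext fun t => (hy t).unique (hzero ▸ hasDerivAt_const t 0)⟩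

theorem trace_eq (he : |e| < 1) (m : ℕ) (Ξ : ℝ → ℝ) : trace m Ξ e =
    hillSol 1 0 (Ξ e) e (2 * m * Real.pi) + hillVel 0 1 (Ξ e) e (2 * m * Real.pi) := by
  have : (fun t => deriv (fun x => F x t e) (X t (Ξ e) e)) = hillCoeff (Ξ e) e :=
    funext fun t => deriv_F he _ _
  rw [trace, this]
  rfl

end LinearizedEquation

section CircularLinearization

variable {ξ s : ℝ}

theorem hillCoeff_zero (ξ t : ℝ) : hillCoeff ξ 0 t = (X t ξ 0 ^ 2 + 1 / 4) ^ (-(3 / 2) : ℝ) -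
    3 * X t ξ 0 ^ 2 * (X t ξ 0 ^ 2 + 1 / 4) ^ (-(5 / 2) : ℝ) := Fx_zero _ _

theorem isHillSolutionOn_X (ξ : ℝ) (S : Set ℝ) : IsHillSolutionOn (hillCoeff ξ 0)
    (fun t => -(3 * X t ξ 0 ^ 3 * (X t ξ 0 ^ 2 + 1 / 4) ^ (-(5 / 2) : ℝ)))
    (fun t => X t ξ 0) (fun t => XDot t ξ 0) S := by
  refine .of_hasDerivAt (hasDerivAt_X_zero · ξ) fun t =>
    (hasDerivAt_XDot_zero t ξ).congr_deriv ?_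
  rw [F_zero, hillCoeff_zero]
  ring

theorem isHillSolutionOn_XDot (ξ : ℝ) (S : Set ℝ) : IsHillSolutionOn (hillCoeff ξ 0) 0
    (fun t => XDot t ξ 0) (fun t => -F (X t ξ 0) 0 0) S := by
  have htime (t : ℝ) : F (X t ξ 0) t 0 = F (X t ξ 0) 0 0 := by simp only [F_zero]
  refine .of_hasDerivAt (fun t => htime t ▸ hasDerivAt_XDot_zero t ξ) fun t => ?_
  refine ((hasDerivAt_F abs_zero_lt_one (X t ξ 0) 0).comp t
    (hasDerivAt_X_zero t ξ)).neg.congr_deriv ?_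
  simp [hillCoeff, Fx_zero]

theorem eq_zero_of_isHillSolutionOn {y v : ℝ → ℝ} {t₀ : ℝ}
    (h : IsHillSolutionOn (hillCoeff ξ 0) 0 y v univ) (hy₀ : y t₀ = 0) (hv₀ : v t₀ = 0) :
    y = 0 ∧ v = 0 :=
  h.eq_zero_of_abs_le (abs_hillCoeff_le abs_zero_lt_one ξ) hy₀ hv₀

theorem hillSol_one_zero_neg (ξ t : ℝ) : hillSol 1 0 ξ 0 (-t) = hillSol 1 0 ξ 0 t ∧
    hillVel 1 0 ξ 0 (-t) = -hillVel 1 0 ξ 0 t := by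
  have he := abs_zero_lt_one
  have hneg : IsHillSolutionOn (hillCoeff ξ 0) 0 (fun t => hillSol 1 0 ξ 0 (-t))
      (fun t => -hillVel 1 0 ξ 0 (-t)) univ := by
    refine .of_hasDerivAt (fun t => hasDerivAt_comp_neg (hasDerivAt_hillSol he 1 0 ξ (-t)))
      fun t => (hasDerivAt_comp_neg (hasDerivAt_hillVel he 1 0 ξ (-t))).neg.congr_deriv ?_
    simp [hillCoeff_zero, X_even he ξ t]
  have hdiff := hneg.add_smul (isHillSolutionOn_hillSol he 1 0 ξ univ) (-1)
  rw [smul_zero, add_zero] at hdiff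
  obtain ⟨hsol, hvel⟩ := eq_zero_of_isHillSolutionOn (t₀ := 0) hdiff (by simp)
    (by simp [hillVel_init he])
  have hsol := congrFun hsol t
  have hvel := congrFun hvel t
  simp only [Pi.add_apply, Pi.smul_apply, Pi.zero_apply, smul_eq_mul] at hsol hvel
  constructor <;> linarith

theorem hillSol_zero_one (hξ : 0 < ξ) (t : ℝ) : hillSol 0 1 ξ 0 t = -XDot t ξ 0 / F ξ 0 0 ∧
    hillVel 0 1 ξ 0 t = F (X t ξ 0) 0 0 / F ξ 0 0 := by
  have he := abs_zero_lt_one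
  have hF := (F_zero_pos hξ 0).ne'
  have hsum := (isHillSolutionOn_XDot ξ univ).add_smul (isHillSolutionOn_hillSol he 0 1 ξ univ)
    (F ξ 0 0)
  rw [smul_zero, add_zero] at hsum
  obtain ⟨hsol, hvel⟩ := eq_zero_of_isHillSolutionOn (t₀ := 0) hsum
    (by simp [hillSol_init he, XDot_init he]) (by simp [hillVel_init he, X_init he])
  have hsol := congrFun hsol t
  have hvel := congrFun hvel t
  simp only [Pi.add_apply, Pi.smul_apply, Pi.zero_apply, smul_eq_mul] at hsol hvel
  constructor <;> rw [eq_div_iff hF] <;> linarith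

theorem nonpos_of_isMinOn_Icc {f : ℝ → ℝ} {f' a b : ℝ} (hmin : IsMinOn f (Icc a b) b)
    (hab : a < b) (hf : HasDerivAt f f' b) : f' ≤ 0 := by
  have hcone : a - b ∈ posTangentConeAt (Icc a b) b :=
    sub_mem_posTangentConeAt_of_segment_subset (by rw [segment_symm, segment_eq_Icc hab.le])
  have hdir : 0 ≤ (a - b) * f' := by
    simpa using hmin.localize.hasFDerivWithinAt_nonneg hf.hasFDerivAt.hasFDerivWithinAt hcone
  exact nonpos_of_mul_nonneg_right hdir (sub_neg.2 hab)

namespace IsQuarterPeriod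

theorem wronskian_pos (h : IsQuarterPeriod ξ s) {b : ℝ} (hb : 0 < b) (hbs : b ≤ s)
    (hy : ∀ t ∈ Ioo 0 b, 0 < hillSol 1 0 ξ 0 t) :
    0 < X b ξ 0 * hillVel 1 0 ξ 0 b - XDot b ξ 0 * hillSol 1 0 ξ 0 b := by
  have he := abs_zero_lt_one
  have hX := continuous_X_zero ξ
  have hψ := isHillSolutionOn_hillSol he 1 0 ξ (Icc 0 b)
  have hf : Continuous fun t => 3 * X t ξ 0 ^ 3 * (X t ξ 0 ^ 2 + 1 / 4) ^ (-(5 / 2) : ℝ) :=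
    (continuous_const.mul (hX.pow 3)).mul ((continuous_sq_add_rpow _).comp hX)
  have hgreen := (isHillSolutionOn_X ξ (Icc 0 b)).integral_eq_wronskian_sub hψ hb.le
    hf.neg.continuousOn continuousOn_const
  have hpos : 0 < ∫ t in (0 : ℝ)..b, 3 * X t ξ 0 ^ 3 * (X t ξ 0 ^ 2 + 1 / 4) ^ (-(5 / 2) : ℝ) *
      hillSol 1 0 ξ 0 t := by
    refine intervalIntegral.intervalIntegral_pos_of_pos_on
      ((hf.continuousOn.mul hψ.continuousOn).intervalIntegrable_of_Icc hb.le) (fun t ht => ?_) hb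
    have := h.pos_of_mem_Ioo t ⟨ht.1, ht.2.trans_le hbs⟩
    have := hy t ht
    positivity
  simp only [Pi.zero_apply, mul_zero, sub_zero, neg_mul, intervalIntegral.integral_neg,
    XDot_zero_init, hillVel_init he, zero_mul] at hgreen
  linarith

theorem hillSol_pos (h : IsQuarterPeriod ξ s) : 0 < hillSol 1 0 ξ 0 s := by
  have he := abs_zero_lt_one
  have hcont : Continuous (hillSol 1 0 ξ 0) :=
    continuousOn_univ.1 (isHillSolutionOn_hillSol he 1 0 ξ univ).continuousOn
  by_contra! hs
  have hcompact : IsCompact (Icc 0 s ∩ {t | hillSol 1 0 ξ 0 t = 0}) :=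
    isCompact_Icc.inter_right (isClosed_eq hcont continuous_const)
  have hzero {t : ℝ} (ht : 0 ≤ t) (hψ : hillSol 1 0 ξ 0 t ≤ 0) :
      ∃ r ∈ Icc 0 t, hillSol 1 0 ξ 0 r = 0 :=
    intermediate_value_Icc' ht hcont.continuousOn ⟨hψ, by simp [hillSol_init he]⟩
  obtain ⟨b, ⟨hb, hψb⟩, hleast⟩ := hcompact.exists_isLeast (hzero h.pos.le hs)
  have hpos : ∀ t ∈ Ico 0 b, 0 < hillSol 1 0 ξ 0 t := fun t ht => by
    by_contra! hψ
    obtain ⟨r, hr, hψr⟩ := hzero ht.1 hψ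
    exact ((hr.2.trans_lt ht.2).not_ge) (hleast ⟨⟨hr.1, (hr.2.trans ht.2.le).trans hb.2⟩, hψr⟩)
  have hb₀ : 0 < b := hb.1.lt_of_ne (by rintro rfl; simp [hillSol_init he] at hψb)
  have hmin : IsMinOn (hillSol 1 0 ξ 0) (Icc 0 b) b := isMinOn_iff.2 fun t ht => by
    rcases ht.2.eq_or_lt with rfl | htb
    exacts [le_rfl, hψb.trans_le (hpos t ⟨ht.1, htb⟩).le]
  have hvel : hillVel 1 0 ξ 0 b ≤ 0 :=
    nonpos_of_isMinOn_Icc hmin hb₀ (hasDerivAt_hillSol he 1 0 ξ b)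
  have hX : 0 ≤ X b ξ 0 := by
    rcases hb.2.eq_or_lt with rfl | hbs
    · exact h.eq_zero.ge
    · exact (h.pos_of_mem b ⟨hb.1, hbs⟩).le
  have hW := h.wronskian_pos hb₀ hb.2 fun t ht => hpos t (Ioo_subset_Ico_self ht)
  rw [hψb, mul_zero, sub_zero] at hW
  exact hW.not_ge (mul_nonpos_of_nonneg_of_nonpos hX hvel)

theorem hillVel_add_two_mul (h : IsQuarterPeriod ξ s) (t : ℝ) : hillVel 1 0 ξ 0 (t + 2 * s) =
    -hillVel 1 0 ξ 0 t + 2 * hillSol 1 0 ξ 0 s / XDot s ξ 0 * F (X t ξ 0) 0 0 := by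
  have he := abs_zero_lt_one
  set κ := 2 * hillSol 1 0 ξ 0 s / XDot s ξ 0
  have hκ : κ * XDot s ξ 0 = 2 * hillSol 1 0 ξ 0 s := div_mul_cancel₀ _ h.XDot_neg.ne
  have hshift : IsHillSolutionOn (hillCoeff ξ 0) 0 (fun t => hillSol 1 0 ξ 0 (t + 2 * s))
      (fun t => hillVel 1 0 ξ 0 (t + 2 * s)) univ := by
    refine .of_hasDerivAt (fun t => (hasDerivAt_hillSol he 1 0 ξ (t + 2 * s)).comp_add_const t _)
      fun t => ((hasDerivAt_hillVel he 1 0 ξ (t + 2 * s)).comp_add_const t _).congr_deriv ?_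
    have hX : X (t + 2 * s) ξ 0 = -X t ξ 0 := X_zero_antiperiodic h.eq_zero t
    simp [hillCoeff_zero, hX]
  have hsum := (hshift.add_smul (isHillSolutionOn_hillSol he 1 0 ξ univ) 1).add_smul
    (isHillSolutionOn_XDot ξ univ) κ
  simp only [smul_zero, add_zero] at hsum
  obtain ⟨-, hvel⟩ := eq_zero_of_isHillSolutionOn (t₀ := -s) hsum
    (by simp [hillSol_one_zero_neg, XDot_odd he ξ s, hκ, two_mul])
    (by simp [two_mul, hillSol_one_zero_neg, X_even he ξ s, h.eq_zero, F])
  have hvel := congrFun hvel t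
  simp only [Pi.add_apply, Pi.smul_apply, Pi.zero_apply, smul_eq_mul] at hvel
  linarith

theorem hillVel_nat_mul (h : IsQuarterPeriod ξ s) (n : ℕ) :
    (-1) ^ n * hillVel 1 0 ξ 0 (n * (2 * s)) =
      n * (-(2 * hillSol 1 0 ξ 0 s / XDot s ξ 0) * F ξ 0 0) := by
  induction n with
  | zero => simp [hillVel_init abs_zero_lt_one]
  | succ k ih =>
    have hX : X (k * (2 * s)) ξ 0 = (-1) ^ k * ξ := by
      simpa [X_zero_init] using (X_zero_antiperiodic h.eq_zero).add_nat_mul_eq k (x := 0)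
    have hF : F ((-1) ^ k * ξ) 0 0 = (-1) ^ k * F ξ 0 0 := by
      rcases neg_one_pow_eq_or ℝ k with hk | hk <;> simp [hk, F_zero]
    have hsq : ((-1 : ℝ) ^ k) * (-1) ^ k = 1 := by simp [← mul_pow]
    rw [show ((k + 1 : ℕ) : ℝ) * (2 * s) = k * (2 * s) + 2 * s by push_cast; ring,
      h.hillVel_add_two_mul, hX, hF, pow_succ]
    push_cast
    linear_combination ih - (2 * hillSol 1 0 ξ 0 s / XDot s ξ 0) * F ξ 0 0 * hsq

theorem hillVel_nat_mul_ne_zero (h : IsQuarterPeriod ξ s) {n : ℕ} (hn : n ≠ 0) :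
    hillVel 1 0 ξ 0 (n * (2 * s)) ≠ 0 := by
  intro h₀
  have heq := h.hillVel_nat_mul n
  have hn₀ : (0 : ℝ) < n := by positivity
  have hκ : 0 < -(2 * hillSol 1 0 ξ 0 s / XDot s ξ 0) :=
    neg_pos.2 (div_neg_of_pos_of_neg (mul_pos two_pos h.hillSol_pos) h.XDot_neg)
  have hF := F_zero_pos h.start_pos 0
  rw [h₀, mul_zero] at heq
  exact (mul_pos hn₀ (mul_pos hκ hF)).ne heq

end IsQuarterPeriod

end CircularLinearization

section CircularForceDerivatives

/-- The amplitude of the first order effect of the eccentricity on the force: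
`∂F/∂e (x, t, 0) = amplitude x * cos t`. -/
noncomputable def amplitude (x : ℝ) : ℝ := 3 / 4 * x * (x ^ 2 + 1 / 4) ^ (-(5 / 2) : ℝ)

/-- The derivative of `amplitude`. -/
noncomputable def amplitudeDeriv (x : ℝ) : ℝ :=
  3 / 4 * (x ^ 2 + 1 / 4) ^ (-(5 / 2) : ℝ) - 15 / 4 * x ^ 2 * (x ^ 2 + 1 / 4) ^ (-(7 / 2) : ℝ)

/-- The second derivative `∂²F/∂x²` of the force of the circular problem. -/
noncomputable def Fxx (x : ℝ) : ℝ :=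
  15 * x ^ 3 * (x ^ 2 + 1 / 4) ^ (-(7 / 2) : ℝ) - 9 * x * (x ^ 2 + 1 / 4) ^ (-(5 / 2) : ℝ)

theorem continuous_amplitude : Continuous amplitude :=
  (continuous_const.mul continuous_id).mul (continuous_sq_add_rpow _)

theorem continuous_amplitudeDeriv : Continuous amplitudeDeriv :=
  (continuous_const.mul (continuous_sq_add_rpow _)).sub
    ((continuous_const.mul (continuous_id.pow 2)).mul (continuous_sq_add_rpow _))

theorem continuous_Fxx : Continuous Fxx :=
  ((continuous_const.mul (continuous_id.pow 3)).mul (continuous_sq_add_rpow _)).sub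
    ((continuous_const.mul continuous_id).mul (continuous_sq_add_rpow _))

theorem hasDerivAt_sq_add_rpow (r x : ℝ) : HasDerivAt (fun x : ℝ => (x ^ 2 + 1 / 4) ^ r)
    (2 * r * x * (x ^ 2 + 1 / 4) ^ (r - 1)) x := by
  have hS : HasDerivAt (fun x : ℝ => x ^ 2 + 1 / 4) (2 * x) x := by
    simpa using (hasDerivAt_pow 2 x).add_const (1 / 4)
  exact (hS.rpow_const (Or.inl (by positivity))).congr_deriv (by ring)

theorem hasDerivAt_amplitude (x : ℝ) : HasDerivAt amplitude (amplitudeDeriv x) x := by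
  refine (((hasDerivAt_id x).const_mul (3 / 4)).mul
    (hasDerivAt_sq_add_rpow (-(5 / 2)) x)).congr_deriv ?_
  rw [show (-(5 / 2) - 1 : ℝ) = -(7 / 2) by norm_num, amplitudeDeriv]
  simp only [id]
  ring

theorem hasDerivAt_Fx_zero (x t : ℝ) : HasDerivAt (fun x => Fx x t 0) (Fxx x) x := by
  simp only [Fx_zero]
  refine ((hasDerivAt_sq_add_rpow (-(3 / 2)) x).sub (((hasDerivAt_pow 2 x).const_mul 3).mul
    (hasDerivAt_sq_add_rpow (-(5 / 2)) x))).congr_deriv ?_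
  rw [show (-(5 / 2) - 1 : ℝ) = -(7 / 2) by norm_num,
    show (-(3 / 2) - 1 : ℝ) = -(5 / 2) by norm_num, Fxx]
  push_cast
  ring

theorem hasDerivAt_sq_add_radius_sq_rpow (r x t : ℝ) :
    HasDerivAt (fun e => (x ^ 2 + radius t e ^ 2) ^ r)
      (-(r / 2) * (x ^ 2 + 1 / 4) ^ (r - 1) * Real.cos t) 0 := by
  have hS₀ : x ^ 2 + radius t 0 ^ 2 = x ^ 2 + 1 / 4 := by rw [radius_zero]; norm_num
  have hS := ((hasDerivAt_radius_zero t).pow 2).const_add (x ^ 2)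
  refine (hS.rpow_const (p := r)
    (Or.inl (by simp only [Pi.pow_apply, hS₀]; positivity))).congr_deriv ?_
  simp only [Pi.pow_apply, hS₀]
  rw [radius_zero]
  push_cast
  ring

theorem hasDerivAt_F_eccentricity (x t : ℝ) :
    HasDerivAt (fun e => F x t e) (amplitude x * Real.cos t) 0 := by
  have hball : ∀ᶠ e : ℝ in 𝓝 0, |e| < 1 := continuous_abs.continuousAt.eventually_lt_const (by simp)
  refine (((hasDerivAt_sq_add_radius_sq_rpow (-(3 / 2)) x t).const_mul
    x).congr_of_eventuallyEq (hball.mono fun e he => F_eq he x t)).congr_deriv ?_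
  rw [show (-(3 / 2) - 1 : ℝ) = -(5 / 2) by norm_num, amplitude]
  ring

theorem hasDerivAt_Fx_eccentricity (x t : ℝ) :
    HasDerivAt (fun e => Fx x t e) (amplitudeDeriv x * Real.cos t) 0 := by
  refine ((hasDerivAt_sq_add_radius_sq_rpow (-(3 / 2)) x t).sub
    ((hasDerivAt_sq_add_radius_sq_rpow (-(5 / 2)) x t).const_mul (3 * x ^ 2))).congr_deriv ?_
  rw [show (-(5 / 2) - 1 : ℝ) = -(7 / 2) by norm_num,
    show (-(3 / 2) - 1 : ℝ) = -(5 / 2) by norm_num, amplitudeDeriv]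
  ring

theorem fderiv_apply_eq_of_partial {f : ℝ × ℝ × ℝ → ℝ} {x t e a b : ℝ}
    (hf : DifferentiableAt ℝ f (x, t, e)) (ha : HasDerivAt (fun x => f (x, t, e)) a x)
    (hb : HasDerivAt (fun e => f (x, t, e)) b e) (η ε : ℝ) :
    fderiv ℝ f (x, t, e) (η, 0, ε) = a * η + b * ε := by
  have hx : fderiv ℝ f (x, t, e) (1, 0, 0) = a := (hf.hasFDerivAt.comp_hasDerivAt x
    ((hasDerivAt_id x).prodMk (hasDerivAt_const x (t, e)))).unique ha
  have he : fderiv ℝ f (x, t, e) (0, 0, 1) = b := (hf.hasFDerivAt.comp_hasDerivAt e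
    ((hasDerivAt_const e x).prodMk ((hasDerivAt_const e t).prodMk (hasDerivAt_id e)))).unique hb
  have hdecomp : ((η, 0, ε) : ℝ × ℝ × ℝ) = η • (1, 0, 0) + ε • (0, 0, 1) := by simp
  rw [hdecomp, map_add, map_smul, map_smul, hx, he, smul_eq_mul, smul_eq_mul, mul_comm a,
    mul_comm b]

theorem fderiv_F_zero (x t η ε : ℝ) :
    fderiv ℝ (fun w : ℝ × ℝ × ℝ => F w.1 w.2.1 w.2.2) (x, t, 0) (η, 0, ε) =
      Fx x t 0 * η + amplitude x * Real.cos t * ε :=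
  fderiv_apply_eq_of_partial
    ((contDiffAt_F (n := 1) one_ne_zero abs_zero_lt_one).differentiableAt (by simp))
    (hasDerivAt_F abs_zero_lt_one x t) (hasDerivAt_F_eccentricity x t) η ε

theorem fderiv_Fx_zero (x t η ε : ℝ) :
    fderiv ℝ (fun w : ℝ × ℝ × ℝ => Fx w.1 w.2.1 w.2.2) (x, t, 0) (η, 0, ε) =
      Fxx x * η + amplitudeDeriv x * Real.cos t * ε :=
  fderiv_apply_eq_of_partial
    ((contDiffAt_Fx (n := 1) one_ne_zero abs_zero_lt_one).differentiableAt (by simp))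
    (hasDerivAt_Fx_zero x t) (hasDerivAt_Fx_eccentricity x t) η ε

end CircularForceDerivatives

section ParameterDependence

variable {a b ξ T : ℝ} {p d : ℝ × ℝ}

/-- Position, time and eccentricity; velocity; a solution of the linearization and its velocity. -/
abbrev Phase : Type := (ℝ × ℝ × ℝ) × ℝ × ℝ × ℝ

/-- The Sitnikov equation together with its linearization, as an autonomous vector field. -/
noncomputable def phaseField (z : Phase) : Phase :=
  ((z.2.1, 1, 0), -F z.1.1 z.1.2.1 z.1.2.2, z.2.2.2, -(Fx z.1.1 z.1.2.1 z.1.2.2 * z.2.2.1))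

/-- The trajectory of `phaseField` with parameters `p = (ξ, e)` whose initial data in the linearized
equation is `(a, b)`. -/
noncomputable def phaseCurve (a b : ℝ) (p : ℝ × ℝ) (t : ℝ) : Phase :=
  ((X t p.1 p.2, t, p.2), XDot t p.1 p.2, hillSol a b p.1 p.2 t, hillVel a b p.1 p.2 t)

theorem isOpen_abs_eccentricity_lt_one : IsOpen {p : ℝ × ℝ | |p.2| < 1} :=
  isOpen_lt (by fun_prop) continuous_const

theorem isOpen_phaseDomain : IsOpen {z : Phase | |z.1.2.2| < 1} :=
  isOpen_lt (by fun_prop) continuous_const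

theorem contDiffOn_phaseField : ContDiffOn ℝ 2 phaseField {z | |z.1.2.2| < 1} := by
  refine fun z hz => ContDiffAt.contDiffWithinAt ?_
  have hF : ContDiffAt ℝ 2 (fun z : Phase => F z.1.1 z.1.2.1 z.1.2.2) z :=
    (contDiffAt_F (n := 2) two_ne_zero (w := z.1) hz).comp z contDiffAt_fst
  have hFx : ContDiffAt ℝ 2 (fun z : Phase => Fx z.1.1 z.1.2.1 z.1.2.2) z :=
    (contDiffAt_Fx (n := 2) two_ne_zero (w := z.1) hz).comp z contDiffAt_fst
  unfold phaseField
  fun_prop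

theorem fderiv_phaseField {z : Phase} (hz : |z.1.2.2| < 1) (h : Phase) :
    fderiv ℝ phaseField z h =
      ((h.2.1, 0, 0), -fderiv ℝ (fun w : ℝ × ℝ × ℝ => F w.1 w.2.1 w.2.2) z.1 h.1,
        h.2.2.2, -(Fx z.1.1 z.1.2.1 z.1.2.2 * h.2.2.1 +
          z.2.2.1 * fderiv ℝ (fun w : ℝ × ℝ × ℝ => Fx w.1 w.2.1 w.2.2) z.1 h.1)) := by
  have hF : HasFDerivAt (𝕜 := ℝ) (fun z : Phase => F z.1.1 z.1.2.1 z.1.2.2) _ z :=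
    ((contDiffAt_F (n := 1) one_ne_zero (w := z.1) hz).differentiableAt
      (by simp)).hasFDerivAt.comp z hasFDerivAt_fst
  have hFx : HasFDerivAt (𝕜 := ℝ) (fun z : Phase => Fx z.1.1 z.1.2.1 z.1.2.2) _ z :=
    ((contDiffAt_Fx (n := 1) one_ne_zero (w := z.1) hz).differentiableAt
      (by simp)).hasFDerivAt.comp z hasFDerivAt_fst
  have hid : HasFDerivAt (fun z : Phase => z) (ContinuousLinearMap.id ℝ Phase) z := hasFDerivAt_id z
  have hfield : HasFDerivAt (𝕜 := ℝ) phaseField _ z :=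
    (hid.snd.fst.prodMk ((hasFDerivAt_const (1 : ℝ) z).prodMk (hasFDerivAt_const (0 : ℝ) z))).prodMk
      (hF.neg.prodMk (hid.snd.snd.snd.prodMk (hFx.mul hid.snd.snd.fst).neg))
  rw [hfield.fderiv]
  simp

theorem hasDerivAt_phaseCurve (hp : |p.2| < 1) (t : ℝ) :
    HasDerivAt (phaseCurve a b p) (phaseField (phaseCurve a b p t)) t :=
  ((hasDerivAt_X hp t p.1).prodMk ((hasDerivAt_id t).prodMk (hasDerivAt_const t p.2))).prodMk
    ((hasDerivAt_XDot hp t p.1).prodMk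
      ((hasDerivAt_hillSol hp a b p.1 t).prodMk (hasDerivAt_hillVel hp a b p.1 t)))

/-- The linear part of the dependence of the initial data of `phaseCurve` on the parameters. -/
noncomputable def phaseInit : ℝ × ℝ →L[ℝ] Phase :=
  ((ContinuousLinearMap.fst ℝ ℝ ℝ).prod
    ((0 : ℝ × ℝ →L[ℝ] ℝ).prod (ContinuousLinearMap.snd ℝ ℝ ℝ))).prod 0

theorem phaseInit_apply (d : ℝ × ℝ) : phaseInit d = ((d.1, 0, d.2), 0) := rfl

theorem isTrajectoryFamily_phaseCurve (a b T : ℝ) :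
    IsTrajectoryFamily phaseField {z | |z.1.2.2| < 1} T phaseInit {p | |p.2| < 1}
      (phaseCurve a b) where
  isIntegralCurveOn _ hp t _ := (hasDerivAt_phaseCurve hp t).hasDerivWithinAt
  mapsTo _ hp _ _ := hp
  sub_eq p hp q hq := by
    simp [phaseCurve, phaseInit_apply, X_init hp, X_init hq, XDot_init hp, XDot_init hq,
      hillSol_init hp, hillSol_init hq, hillVel_init hp, hillVel_init hq]

theorem contDiffOn_phaseCurve (a b : ℝ) {t : ℝ} (ht : 0 ≤ t) :
    ContDiffOn ℝ 1 (fun p => phaseCurve a b p t) {p | |p.2| < 1} :=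
  (isTrajectoryFamily_phaseCurve a b t).contDiffOn isOpen_phaseDomain contDiffOn_phaseField
    isOpen_abs_eccentricity_lt_one (right_mem_Icc.2 ht)

theorem isIntegralCurveOn_fderiv_phaseCurve (hp : |p.2| < 1) (hT : 0 ≤ T) (d : ℝ × ℝ) :
    IsIntegralCurveOn (fun t => fderiv ℝ (fun p => phaseCurve a b p t) p d)
      (fun t => fderiv ℝ phaseField (phaseCurve a b p t)) (Icc 0 T) := by
  have hz := isTrajectoryFamily_phaseCurve a b T
  have hV : ContDiffOn ℝ 1 phaseField _ := contDiffOn_phaseField.of_le one_le_two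
  obtain ⟨Y, hY⟩ := hz.exists_isVariationalSolution isOpen_phaseDomain hV hT hp
  have heq : ∀ t ∈ Icc 0 T, fderiv ℝ (fun p => phaseCurve a b p t) p d = Y t d := fun t ht => by
    rw [(hz.hasFDerivAt isOpen_phaseDomain hV isOpen_abs_eccentricity_lt_one hp hY ht).fderiv]
  exact fun t ht => ((hY.isIntegralCurveOn_apply d t ht).congr heq (heq t ht)).congr_deriv
    (congrArg _ (heq t ht).symm)

end ParameterDependence

section FirstVariation

variable {a b ξ t T : ℝ} {d : ℝ × ℝ}

/-- The derivative at `(ξ, 0)` of `(ξ, e) ↦ X t ξ e` in the direction `d`. -/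
noncomputable def varX (ξ : ℝ) (d : ℝ × ℝ) (t : ℝ) : ℝ :=
  fderiv ℝ (fun p : ℝ × ℝ => X t p.1 p.2) (ξ, 0) d

/-- The derivative at `(ξ, 0)` of `(ξ, e) ↦ XDot t ξ e` in the direction `d`. -/
noncomputable def varXDot (ξ : ℝ) (d : ℝ × ℝ) (t : ℝ) : ℝ :=
  fderiv ℝ (fun p : ℝ × ℝ => XDot t p.1 p.2) (ξ, 0) d

/-- The derivative at `(ξ, 0)` of `(ξ, e) ↦ hillSol a b ξ e t` in the direction `d`. -/
noncomputable def varHillSol (a b ξ : ℝ) (d : ℝ × ℝ) (t : ℝ) : ℝ :=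
  fderiv ℝ (fun p : ℝ × ℝ => hillSol a b p.1 p.2 t) (ξ, 0) d

/-- The derivative at `(ξ, 0)` of `(ξ, e) ↦ hillVel a b ξ e t` in the direction `d`. -/
noncomputable def varHillVel (a b ξ : ℝ) (d : ℝ × ℝ) (t : ℝ) : ℝ :=
  fderiv ℝ (fun p : ℝ × ℝ => hillVel a b p.1 p.2 t) (ξ, 0) d

/-- The derivative at `(ξ, 0)` of `(ξ, e) ↦ hillCoeff ξ e t` in the direction `d`. -/
noncomputable def varHillCoeff (ξ : ℝ) (d : ℝ × ℝ) (t : ℝ) : ℝ :=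
  Fxx (X t ξ 0) * varX ξ d t + amplitudeDeriv (X t ξ 0) * Real.cos t * d.2

theorem differentiableAt_phaseCurve (a b ξ : ℝ) (ht : 0 ≤ t) :
    DifferentiableAt ℝ (fun p => phaseCurve a b p t) (ξ, 0) :=
  ((contDiffOn_phaseCurve a b ht).contDiffAt
    (isOpen_abs_eccentricity_lt_one.mem_nhds abs_zero_lt_one)).differentiableAt one_ne_zero

theorem contDiffOn_XDot (ht : 0 ≤ t) :
    ContDiffOn ℝ 1 (fun p : ℝ × ℝ => XDot t p.1 p.2) {p | |p.2| < 1} :=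
  (contDiffOn_phaseCurve 0 0 ht).snd.fst

theorem hasFDerivAt_XDot (ξ : ℝ) (ht : 0 ≤ t) : HasFDerivAt (fun p : ℝ × ℝ => XDot t p.1 p.2)
    (fderiv ℝ (fun p : ℝ × ℝ => XDot t p.1 p.2) (ξ, 0)) (ξ, 0) :=
  (differentiableAt_phaseCurve 0 0 ξ ht).snd.fst.hasFDerivAt

theorem hasFDerivAt_hillSol (a b ξ : ℝ) (ht : 0 ≤ t) :
    HasFDerivAt (fun p : ℝ × ℝ => hillSol a b p.1 p.2 t)
      (fderiv ℝ (fun p : ℝ × ℝ => hillSol a b p.1 p.2 t) (ξ, 0)) (ξ, 0) :=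
  (differentiableAt_phaseCurve a b ξ ht).snd.snd.fst.hasFDerivAt

theorem hasFDerivAt_hillVel (a b ξ : ℝ) (ht : 0 ≤ t) :
    HasFDerivAt (fun p : ℝ × ℝ => hillVel a b p.1 p.2 t)
      (fderiv ℝ (fun p : ℝ × ℝ => hillVel a b p.1 p.2 t) (ξ, 0)) (ξ, 0) :=
  (differentiableAt_phaseCurve a b ξ ht).snd.snd.snd.hasFDerivAt

theorem fderiv_phaseCurve_apply (a b ξ : ℝ) (d : ℝ × ℝ) (ht : 0 ≤ t) :
    fderiv ℝ (fun p => phaseCurve a b p t) (ξ, 0) d =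
      ((varX ξ d t, 0, d.2), varXDot ξ d t, varHillSol a b ξ d t, varHillVel a b ξ d t) := by
  have hX : HasFDerivAt (fun p : ℝ × ℝ => X t p.1 p.2) _ (ξ, 0) :=
    (differentiableAt_phaseCurve a b ξ ht).fst.fst.hasFDerivAt
  have hcurve : HasFDerivAt (𝕜 := ℝ) (fun p => phaseCurve a b p t) _ (ξ, 0) :=
    (hX.prodMk ((hasFDerivAt_const t (ξ, (0 : ℝ))).prodMk hasFDerivAt_snd)).prodMk
      ((hasFDerivAt_XDot ξ ht).prodMk
        ((hasFDerivAt_hillSol a b ξ ht).prodMk (hasFDerivAt_hillVel a b ξ ht)))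
  exact congrArg (· d) hcurve.fderiv

theorem hasDerivWithinAt_variation (a b ξ : ℝ) (d : ℝ × ℝ) (ht : t ∈ Icc 0 T) :
    HasDerivWithinAt (fun t => (((varX ξ d t, 0, d.2), varXDot ξ d t, varHillSol a b ξ d t,
        varHillVel a b ξ d t) : Phase))
      ((varXDot ξ d t, 0, 0), -(amplitude (X t ξ 0) * Real.cos t * d.2) -
          hillCoeff ξ 0 t * varX ξ d t, varHillVel a b ξ d t,
        -(hillSol a b ξ 0 t * varHillCoeff ξ d t) - hillCoeff ξ 0 t * varHillSol a b ξ d t)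
      (Icc 0 T) t := by
  have heq : ∀ t ∈ Icc 0 T, _ = fderiv ℝ (fun p => phaseCurve a b p t) (ξ, 0) d := fun t ht =>
    (fderiv_phaseCurve_apply a b ξ d ht.1).symm
  have hvar := isIntegralCurveOn_fderiv_phaseCurve (a := a) (b := b) (p := (ξ, 0))
    abs_zero_lt_one (ht.1.trans ht.2) d t ht
  refine (hvar.congr heq (heq t ht)).congr_deriv ?_
  beta_reduce
  rw [fderiv_phaseCurve_apply a b ξ d ht.1, fderiv_phaseField (by exact abs_zero_lt_one)]
  simp only [phaseCurve, fderiv_F_zero, fderiv_Fx_zero, varHillCoeff, hillCoeff, Prod.mk.injEq,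
    true_and]
  constructor <;> ring

theorem isHillSolutionOn_varX (ξ : ℝ) (d : ℝ × ℝ) (T : ℝ) : IsHillSolutionOn (hillCoeff ξ 0)
    (fun t => -(amplitude (X t ξ 0) * Real.cos t * d.2)) (varX ξ d) (varXDot ξ d) (Icc 0 T) :=
  ⟨fun _ ht => (hasDerivWithinAt_variation 0 0 ξ d ht).fst.fst,
    fun _ ht => (hasDerivWithinAt_variation 0 0 ξ d ht).snd.fst⟩

theorem isHillSolutionOn_varHillSol (a b ξ : ℝ) (d : ℝ × ℝ) (T : ℝ) :
    IsHillSolutionOn (hillCoeff ξ 0) (fun t => -(hillSol a b ξ 0 t * varHillCoeff ξ d t))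
      (varHillSol a b ξ d) (varHillVel a b ξ d) (Icc 0 T) :=
  ⟨fun _ ht => (hasDerivWithinAt_variation a b ξ d ht).snd.snd.fst,
    fun _ ht => (hasDerivWithinAt_variation a b ξ d ht).snd.snd.snd⟩

theorem fderiv_apply_eq_zero_of_forall_abs_lt {f : ℝ × ℝ → ℝ} {c : ℝ}
    (hf : ∀ p : ℝ × ℝ, |p.2| < 1 → f p = c) (ξ : ℝ) (d : ℝ × ℝ) : fderiv ℝ f (ξ, 0) d = 0 := by
  have hev : f =ᶠ[𝓝 (ξ, 0)] fun _ => c := by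
    filter_upwards [isOpen_abs_eccentricity_lt_one.mem_nhds abs_zero_lt_one] using hf
  rw [hev.fderiv_eq, fderiv_const_apply, zero_apply]

theorem varX_init (ξ : ℝ) (d : ℝ × ℝ) : varX ξ d 0 = d.1 := by
  have hev : (fun p : ℝ × ℝ => X 0 p.1 p.2) =ᶠ[𝓝 (ξ, 0)] Prod.fst := by
    filter_upwards [isOpen_abs_eccentricity_lt_one.mem_nhds abs_zero_lt_one] with p hp
    exact X_init hp p.1
  rw [varX, hev.fderiv_eq, fderiv_fst, ContinuousLinearMap.coe_fst']

theorem varXDot_init (ξ : ℝ) (d : ℝ × ℝ) : varXDot ξ d 0 = 0 :=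
  fderiv_apply_eq_zero_of_forall_abs_lt (fun p hp => XDot_init hp p.1) ξ d

theorem varHillSol_init (a b ξ : ℝ) (d : ℝ × ℝ) : varHillSol a b ξ d 0 = 0 :=
  fderiv_apply_eq_zero_of_forall_abs_lt (fun p hp => hillSol_init hp a b p.1) ξ d

theorem varHillVel_init (a b ξ : ℝ) (d : ℝ × ℝ) : varHillVel a b ξ d 0 = 0 :=
  fderiv_apply_eq_zero_of_forall_abs_lt (fun p hp => hillVel_init hp a b p.1) ξ d

theorem continuousOn_varHillCoeff (ξ : ℝ) (d : ℝ × ℝ) (T : ℝ) :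
    ContinuousOn (varHillCoeff ξ d) (Icc 0 T) :=
  ((continuous_Fxx.comp (continuous_X_zero ξ)).continuousOn.mul
    (isHillSolutionOn_varX ξ d T).continuousOn).add
      (((continuous_amplitudeDeriv.comp (continuous_X_zero ξ)).mul
        Real.continuous_cos).mul_const d.2).continuousOn

theorem IsHillSolutionOn.wronskian_eq {q y₁ y₂ v₁ v₂ : ℝ → ℝ} {a b : ℝ}
    (h₁ : IsHillSolutionOn q 0 y₁ v₁ (Icc a b)) (h₂ : IsHillSolutionOn q 0 y₂ v₂ (Icc a b))
    (hab : a ≤ b) : v₁ b * y₂ b - y₁ b * v₂ b = v₁ a * y₂ a - y₁ a * v₂ a := by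
  have hgreen := h₁.integral_eq_wronskian_sub h₂ hab continuousOn_const continuousOn_const
  simp only [Pi.zero_apply, zero_mul, mul_zero, sub_zero, intervalIntegral.integral_zero] at hgreen
  linarith

theorem wronskian_hillSol (ξ : ℝ) (hT : 0 ≤ T) : hillSol 1 0 ξ 0 T * hillVel 0 1 ξ 0 T -
    hillVel 1 0 ξ 0 T * hillSol 0 1 ξ 0 T = 1 := by
  have he := abs_zero_lt_one
  have hW := (isHillSolutionOn_hillSol he 1 0 ξ (Icc 0 T)).wronskian_eq
    (isHillSolutionOn_hillSol he 0 1 ξ (Icc 0 T)) hT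
  simp only [hillSol_init he, hillVel_init he] at hW
  linarith

theorem varXDot_one_zero (ξ : ℝ) (hT : 0 ≤ T) : varXDot ξ (1, 0) T = hillVel 1 0 ξ 0 T := by
  have he := abs_zero_lt_one
  have hη : IsHillSolutionOn (hillCoeff ξ 0) 0 (varX ξ (1, 0)) (varXDot ξ (1, 0)) (Icc 0 T) := by
    convert isHillSolutionOn_varX ξ (1, 0) T using 2
    simp
  have hW₁ := hη.wronskian_eq (isHillSolutionOn_hillSol he 1 0 ξ (Icc 0 T)) hT
  have hW₂ := hη.wronskian_eq (isHillSolutionOn_hillSol he 0 1 ξ (Icc 0 T)) hT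
  simp only [hillSol_init he, hillVel_init he, varX_init, varXDot_init] at hW₁ hW₂
  linear_combination hillVel 0 1 ξ 0 T * hW₁ - hillVel 1 0 ξ 0 T * hW₂ -
    varXDot ξ (1, 0) T * wronskian_hillSol ξ hT

theorem varHill_trace_eq (hξ : 0 < ξ) (hT : 0 ≤ T) (hX : X T ξ 0 = ξ) (hXDot : XDot T ξ 0 = 0)
    (d : ℝ × ℝ) : varHillSol 1 0 ξ d T + varHillVel 0 1 ξ d T =
      varHillSol 0 1 ξ d T * hillVel 1 0 ξ 0 T := by
  have he := abs_zero_lt_one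
  have hψ₁ := isHillSolutionOn_hillSol he 1 0 ξ (Icc 0 T)
  have hψ₂ := isHillSolutionOn_hillSol he 0 1 ξ (Icc 0 T)
  have hφ := continuousOn_varHillCoeff ξ d T
  have hsol : hillSol 0 1 ξ 0 T = 0 := by rw [(hillSol_zero_one hξ T).1, hXDot]; simp
  have hvel : hillVel 0 1 ξ 0 T = 1 := by
    rw [(hillSol_zero_one hξ T).2, hX, div_self (F_zero_pos hξ 0).ne']
  have hone : hillSol 1 0 ξ 0 T = 1 := by simpa [hsol, hvel] using wronskian_hillSol ξ hT
  have hgreen₁ := (isHillSolutionOn_varHillSol 1 0 ξ d T).integral_eq_wronskian_sub hψ₂ hT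
    (hψ₁.continuousOn.mul hφ).neg continuousOn_const
  have hgreen₂ := (isHillSolutionOn_varHillSol 0 1 ξ d T).integral_eq_wronskian_sub hψ₁ hT
    (hψ₂.continuousOn.mul hφ).neg continuousOn_const
  have hintegral : ∫ t in (0 : ℝ)..T, -(hillSol 1 0 ξ 0 t * varHillCoeff ξ d t) * hillSol 0 1 ξ 0 t
      = ∫ t in (0 : ℝ)..T, -(hillSol 0 1 ξ 0 t * varHillCoeff ξ d t) * hillSol 1 0 ξ 0 t :=
    intervalIntegral.integral_congr fun t _ => by ring
  simp only [Pi.zero_apply, mul_zero, sub_zero, zero_mul, mul_one, zero_sub, hsol, hvel, hone,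
    varHillSol_init, varHillVel_init] at hgreen₁ hgreen₂
  linarith

theorem hasDerivAt_hillCoeff_zero (ξ t : ℝ) :
    HasDerivAt (hillCoeff ξ 0) (Fxx (X t ξ 0) * XDot t ξ 0) t := by
  have htime : hillCoeff ξ 0 = fun t => Fx (X t ξ 0) 0 0 :=
    funext fun t => by rw [hillCoeff, Fx_zero, Fx_zero]
  rw [htime]
  exact (hasDerivAt_Fx_zero (X t ξ 0) 0).comp t (hasDerivAt_X_zero t ξ)

theorem isHillSolutionOn_varXDot (ξ : ℝ) (d : ℝ × ℝ) (T : ℝ) : IsHillSolutionOn (hillCoeff ξ 0)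
    (fun t => amplitude (X t ξ 0) * Real.sin t * d.2 - XDot t ξ 0 * varHillCoeff ξ d t)
    (varXDot ξ d) (fun t => -(amplitude (X t ξ 0) * Real.cos t * d.2) -
      hillCoeff ξ 0 t * varX ξ d t) (Icc 0 T) := by
  have hη := isHillSolutionOn_varX ξ d T
  refine ⟨hη.hasDerivWithinAt_velocity, fun t ht => ?_⟩
  have hamp : HasDerivAt (fun t => amplitude (X t ξ 0))
      (amplitudeDeriv (X t ξ 0) * XDot t ξ 0) t :=
    (hasDerivAt_amplitude _).comp t (hasDerivAt_X_zero t ξ)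
  refine (((hamp.mul (Real.hasDerivAt_cos t)).mul_const d.2).neg.hasDerivWithinAt.sub
    ((hasDerivAt_hillCoeff_zero ξ t).hasDerivWithinAt.mul
      (hη.hasDerivWithinAt t ht))).congr_deriv ?_
  rw [varHillCoeff]
  ring

/-- Since `XDot` is a multiple of the second fundamental solution, the variation of the coefficient
cancels in this combination. -/
theorem isHillSolutionOn_varXDot_add_varHillSol (hξ : 0 < ξ) (d : ℝ × ℝ) (T : ℝ) :
    IsHillSolutionOn (hillCoeff ξ 0) (fun t => amplitude (X t ξ 0) * Real.sin t * d.2)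
      (varXDot ξ d + F ξ 0 0 • varHillSol 0 1 ξ d)
      ((fun t => -(amplitude (X t ξ 0) * Real.cos t * d.2) - hillCoeff ξ 0 t * varX ξ d t) +
        F ξ 0 0 • varHillVel 0 1 ξ d) (Icc 0 T) := by
  convert (isHillSolutionOn_varXDot ξ d T).add_smul
    (isHillSolutionOn_varHillSol 0 1 ξ d T) (F ξ 0 0) using 1
  funext t
  have hF := (F_zero_pos hξ 0).ne'
  simp only [Pi.add_apply, Pi.smul_apply, smul_eq_mul, (hillSol_zero_one hξ t).1]
  field_simp
  ring

theorem varXDot_add_varHillSol_mul_eq (hξ : 0 < ξ) (hT : 0 ≤ T) (hX : X T ξ 0 = ξ)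
    (hXDot : XDot T ξ 0 = 0) (d : ℝ × ℝ) :
    (varXDot ξ d T + F ξ 0 0 * varHillSol 0 1 ξ d T) * F ξ 0 0 =
      d.2 * ∫ t in (0 : ℝ)..T, amplitude (X t ξ 0) * XDot t ξ 0 * Real.sin t := by
  have hamp := continuous_amplitude.comp (continuous_X_zero ξ)
  have hgreen := (isHillSolutionOn_varXDot_add_varHillSol hξ d T).integral_eq_wronskian_sub
    (isHillSolutionOn_XDot ξ (Icc 0 T)) hT
    ((hamp.mul Real.continuous_sin).mul_const d.2).continuousOn continuousOn_const
  have hintegrand (t : ℝ) : amplitude (X t ξ 0) * Real.sin t * d.2 * XDot t ξ 0 =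
      d.2 * (amplitude (X t ξ 0) * XDot t ξ 0 * Real.sin t) := by ring
  simp only [Pi.add_apply, Pi.smul_apply, Pi.zero_apply, smul_eq_mul, mul_zero, sub_zero, hXDot,
    XDot_zero_init, varXDot_init, varHillSol_init, hX, hintegrand,
    intervalIntegral.integral_const_mul] at hgreen
  linarith

end FirstVariation

section Fourier

theorem integral_eq_zero_of_mul_shift {𝕜 : Type*} [RCLike 𝕜] {f : ℝ → 𝕜} {σ T : ℝ} {c : 𝕜}
    (hT : Periodic f T) (hσ : ∀ t, f (t + σ) = c * f t) (hc : c ≠ 1) :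
    ∫ t in (0 : ℝ)..T, f t = 0 := by
  have hshift : c * ∫ t in (0 : ℝ)..T, f t = ∫ t in (0 : ℝ)..T, f t := by
    calc c * ∫ t in (0 : ℝ)..T, f t = ∫ t in (0 : ℝ)..T, f (t + σ) := by
          simp only [hσ, intervalIntegral.integral_const_mul]
      _ = ∫ t in σ..σ + T, f t := by
          rw [intervalIntegral.integral_comp_add_right, zero_add, add_comm T]
      _ = ∫ t in (0 : ℝ)..T, f t := by rw [hT.intervalIntegral_add_eq σ 0, zero_add]
  exact (mul_left_eq_self₀.1 hshift).resolve_left hc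

theorem integral_mul_sin_eq_zero {h : ℝ → ℝ} {σ : ℝ} (hh : Continuous h) (hσ : Periodic h σ)
    (m : ℕ) (hT : Periodic h (m * (2 * Real.pi))) (hcos : Real.cos σ ≠ 1) :
    ∫ t in (0 : ℝ)..m * (2 * Real.pi), h t * Real.sin t = 0 := by
  have hexp : Complex.exp (σ * Complex.I) ≠ 1 := fun hσ₁ =>
    hcos (by simpa using congrArg Complex.re hσ₁)
  set f : ℝ → ℂ := fun t => h t * Complex.exp (t * Complex.I) with hf
  have hint : ∫ t in (0 : ℝ)..m * (2 * Real.pi), f t = 0 := by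
    refine integral_eq_zero_of_mul_shift (σ := σ) (fun t => ?_) (fun t => ?_) hexp
    · have hper := Complex.exp_mul_I_periodic.nat_mul m t
      simp only [hf, hT t]
      push_cast
      rw [hper]
    · simp only [hf, hσ t]
      push_cast
      rw [add_mul, Complex.exp_add]
      ring
  have him := intervalIntegral.intervalIntegral_im (f := f) (μ := MeasureTheory.volume)
    (Continuous.intervalIntegrable (by fun_prop) 0 (m * (2 * Real.pi)))
  rw [hint] at him
  simpa [hf, Complex.exp_ofReal_mul_I_im] using him

end Fourier

section TraceDerivative

variable {m p : ℕ} {ξ s : ℝ}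

theorem IsQuarterPeriod.integral_amplitude_mul_XDot_mul_sin (h : IsQuarterPeriod ξ s)
    (hT : Periodic (fun t => X t ξ 0) (m * (2 * Real.pi)))
    (hT' : Periodic (fun t => XDot t ξ 0) (m * (2 * Real.pi))) (hcos : Real.cos (2 * s) ≠ 1) :
    ∫ t in (0 : ℝ)..m * (2 * Real.pi), amplitude (X t ξ 0) * XDot t ξ 0 * Real.sin t = 0 := by
  have hXDot : Continuous fun t => XDot t ξ 0 :=
    continuousOn_univ.1 (isHillSolutionOn_XDot ξ univ).continuousOn
  refine integral_mul_sin_eq_zero (h := fun t => amplitude (X t ξ 0) * XDot t ξ 0)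
    ((continuous_amplitude.comp (continuous_X_zero ξ)).mul hXDot) (fun t => ?_) m (fun t => ?_) hcos
  · have hX : X (t + 2 * s) ξ 0 = -X t ξ 0 := X_zero_antiperiodic h.eq_zero t
    have hV : XDot (t + 2 * s) ξ 0 = -XDot t ξ 0 := XDot_zero_antiperiodic h.eq_zero t
    simp only [hX, hV, amplitude, neg_sq]
    ring
  · have hX : X (t + m * (2 * Real.pi)) ξ 0 = X t ξ 0 := hT t
    have hV : XDot (t + m * (2 * Real.pi)) ξ 0 = XDot t ξ 0 := hT' t
    simp only [hX, hV]

theorem cos_ne_one_of_ne (hm : 0 < m) (hp : 0 < p)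
    (hne : ∀ n : ℕ, 1 ≤ n → (p : ℝ) / m ≠ 1 / (2 * n)) : Real.cos (m * Real.pi / p) ≠ 1 := by
  have hm₀ : (0 : ℝ) < m := Nat.cast_pos.2 hm
  have hp₀ : (0 : ℝ) < p := Nat.cast_pos.2 hp
  intro h
  obtain ⟨k, hk⟩ := (Real.cos_eq_one_iff _).1 h
  have hkm : (k : ℝ) * (2 * p) = m := by
    rw [eq_div_iff hp₀.ne'] at hk
    exact mul_right_cancel₀ Real.pi_ne_zero (by linarith)
  have hk₀ : 0 < (k : ℝ) := pos_of_mul_pos_left (hkm ▸ hm₀) (by positivity)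
  lift k to ℕ using (Int.cast_pos.1 hk₀).le
  rw [Int.cast_natCast] at hkm hk₀
  refine hne k (Nat.cast_pos.1 hk₀) ?_
  rw [← hkm]
  field_simp

namespace IsEvenFamily

variable {e₀ e : ℝ} {Ξ : ℝ → ℝ}

theorem abs_lt_one (h : IsEvenFamily m p e₀ Ξ) (he : e ∈ Ico 0 e₀) : |e| < 1 := by
  rw [abs_of_nonneg he.1]
  exact he.2.trans_le h.le_one

theorem zero_mem (h : IsEvenFamily m p e₀ Ξ) : 0 ∈ Ico 0 e₀ := ⟨le_rfl, h.pos⟩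

theorem pos_and_pos (h : IsEvenFamily m p e₀ Ξ) : 0 < m ∧ 0 < p := by
  have hT : 0 < 2 * m * Real.pi / p := h.start_period.1.1
  constructor <;> refine Nat.pos_of_ne_zero ?_ <;> rintro rfl <;> simp at hT

theorem isQuarterPeriod (h : IsEvenFamily m p e₀ Ξ) :
    IsQuarterPeriod (Ξ 0) (m * Real.pi / p / 2) := by
  convert isQuarterPeriod_of_hasMinimalPeriod h.start_pos h.start_period using 1
  ring

theorem hasDerivWithinAt_prodMk (h : IsEvenFamily m p e₀ Ξ) :
    HasDerivWithinAt (fun e => (Ξ e, e)) (derivWithin Ξ (Ico 0 e₀) 0, 1) (Ico 0 e₀) 0 :=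
  (h.contDiffOn.differentiableOn one_ne_zero 0 h.zero_mem).hasDerivWithinAt.prodMk
    (hasDerivWithinAt_id 0 _)

theorem varXDot_eq_zero (h : IsEvenFamily m p e₀ Ξ) :
    varXDot (Ξ 0) (derivWithin Ξ (Ico 0 e₀) 0, 1) (m * (2 * Real.pi)) = 0 := by
  have hT : 0 ≤ m * (2 * Real.pi) := by positivity
  have hder := (hasFDerivAt_XDot (Ξ 0) hT).comp_hasDerivWithinAt_of_eq 0
    h.hasDerivWithinAt_prodMk rfl
  refine (uniqueDiffOn_Ico 0 e₀ 0 h.zero_mem).eq_deriv _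
    (hder.congr_of_mem (f₁ := fun _ => 0) (fun e he => ?_) h.zero_mem)
    (hasDerivWithinAt_const 0 _ 0)
  simpa [XDot_init (h.abs_lt_one he)] using
    (XDot_periodic (h.abs_lt_one he) (h.deriv_eq_zero e he) 0).symm

theorem X_periodic_zero (h : IsEvenFamily m p e₀ Ξ) :
    Periodic (fun t => X t (Ξ 0) 0) (m * (2 * Real.pi)) :=
  X_periodic abs_zero_lt_one (h.deriv_eq_zero 0 h.zero_mem)

theorem XDot_periodic_zero (h : IsEvenFamily m p e₀ Ξ) :
    Periodic (fun t => XDot t (Ξ 0) 0) (m * (2 * Real.pi)) :=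
  XDot_periodic abs_zero_lt_one (h.deriv_eq_zero 0 h.zero_mem)

theorem X_two_pi_mul (h : IsEvenFamily m p e₀ Ξ) : X (m * (2 * Real.pi)) (Ξ 0) 0 = Ξ 0 := by
  simpa [X_zero_init] using h.X_periodic_zero 0

theorem XDot_two_pi_mul (h : IsEvenFamily m p e₀ Ξ) :
    XDot (m * (2 * Real.pi)) (Ξ 0) 0 = 0 := by
  simpa [XDot_zero_init] using h.XDot_periodic_zero 0

theorem varHillSol_eq_zero (h : IsEvenFamily m p e₀ Ξ)
    (hne : ∀ n : ℕ, 1 ≤ n → (p : ℝ) / m ≠ 1 / (2 * n)) :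
    varHillSol 0 1 (Ξ 0) (derivWithin Ξ (Ico 0 e₀) 0, 1) (m * (2 * Real.pi)) = 0 := by
  have hcos : Real.cos (2 * (m * Real.pi / p / 2)) ≠ 1 := by
    rw [mul_div_cancel₀ _ two_ne_zero]
    exact cos_ne_one_of_ne h.pos_and_pos.1 h.pos_and_pos.2 hne
  have hF := (F_zero_pos h.start_pos 0).ne'
  have hboundary := varXDot_add_varHillSol_mul_eq h.start_pos (by positivity) h.X_two_pi_mul
    h.XDot_two_pi_mul (derivWithin Ξ (Ico 0 e₀) 0, 1)
  rw [h.isQuarterPeriod.integral_amplitude_mul_XDot_mul_sin h.X_periodic_zero h.XDot_periodic_zero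
    hcos, h.varXDot_eq_zero, zero_add, mul_zero] at hboundary
  simpa [hF] using hboundary

theorem hasDerivWithinAt_trace (h : IsEvenFamily m p e₀ Ξ)
    (hne : ∀ n : ℕ, 1 ≤ n → (p : ℝ) / m ≠ 1 / (2 * n)) :
    HasDerivWithinAt (trace m Ξ) 0 (Ici 0) 0 := by
  have hT : 0 ≤ m * (2 * Real.pi) := by positivity
  have hcurve := h.hasDerivWithinAt_prodMk
  have htrace := ((hasFDerivAt_hillSol 1 0 (Ξ 0) hT).comp_hasDerivWithinAt_of_eq 0 hcurve rfl).add
    ((hasFDerivAt_hillVel 0 1 (Ξ 0) hT).comp_hasDerivWithinAt_of_eq 0 hcurve rfl)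
  have hvar := varHill_trace_eq h.start_pos hT h.X_two_pi_mul h.XDot_two_pi_mul
    (derivWithin Ξ (Ico 0 e₀) 0, 1)
  rw [h.varHillSol_eq_zero hne, zero_mul] at hvar
  refine ((htrace.congr_of_mem (fun e he => ?_) h.zero_mem).congr_deriv hvar).mono_of_mem_nhdsWithin
    (Ico_mem_nhdsGE h.pos)
  rw [trace_eq (h.abs_lt_one he), mul_comm (2 : ℝ), mul_assoc]
  rfl

end IsEvenFamily

end TraceDerivative

section Continuation

variable {m p : ℕ} {ξ s T : ℝ}

theorem contDiffAt_XDot_swap (ξ : ℝ) (hT : 0 ≤ T) :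
    ContDiffAt ℝ 1 (fun q : ℝ × ℝ => XDot T q.2 q.1) (0, ξ) :=
  ((contDiffOn_XDot hT).contDiffAt (x := (ξ, 0))
    (isOpen_abs_eccentricity_lt_one.mem_nhds (by simp))).comp (0, ξ)
    (f := fun q : ℝ × ℝ => (q.2, q.1)) (by fun_prop)

theorem hasDerivAt_XDot_initial (ξ : ℝ) (hT : 0 ≤ T) :
    HasDerivAt (fun ξ => XDot T ξ 0) (hillVel 1 0 ξ 0 T) ξ := by
  rw [← varXDot_one_zero ξ hT]
  exact (hasFDerivAt_XDot ξ hT).comp_hasDerivAt ξ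
    ((hasDerivAt_id ξ).prodMk (hasDerivAt_const ξ (0 : ℝ)))

theorem isInvertible_fderiv_XDot_swap (hT : 0 ≤ T) (h : hillVel 1 0 ξ 0 T ≠ 0) :
    (fderiv ℝ (fun q : ℝ × ℝ => XDot T q.2 q.1) (0, ξ) ∘L .inr ℝ ℝ ℝ).IsInvertible :=
  isInvertible_comp_inr
    ((contDiffAt_XDot_swap ξ hT).differentiableAt one_ne_zero).hasFDerivAt
    (hasDerivAt_XDot_initial ξ hT) h

theorem exists_contDiffOn_XDot_eq_zero (hT : 0 ≤ T) (h₀ : XDot T ξ 0 = 0)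
    (h : hillVel 1 0 ξ 0 T ≠ 0) : ∃ e₀ Ξ, 0 < e₀ ∧ e₀ ≤ 1 ∧ ContDiffOn ℝ 1 Ξ (Ico 0 e₀) ∧
      Ξ 0 = ξ ∧ ∀ e ∈ Ico 0 e₀, XDot T (Ξ e) e = 0 := by
  have hf := contDiffAt_XDot_swap ξ hT
  have hinv := isInvertible_fderiv_XDot_swap hT h
  have hΞ : ContDiffAt ℝ 1 (hf.implicitFunction one_ne_zero hinv) 0 :=
    hf.contDiffAt_implicitFunction one_ne_zero hinv
  obtain ⟨ε, hε, hball⟩ := Metric.eventually_nhds_iff.1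
    ((hf.eventually_apply_implicitFunction one_ne_zero hinv).and (hΞ.eventually (by simp)))
  have hdist : ∀ e ∈ Ico 0 (min ε 1), dist e 0 < ε := fun e he => by
    rw [dist_zero_right, Real.norm_eq_abs, abs_of_nonneg he.1]
    exact he.2.trans_le (min_le_left _ _)
  exact ⟨min ε 1, _, lt_min hε one_pos, min_le_right _ _,
    fun e he => (hball (hdist e he)).2.contDiffWithinAt,
    hf.implicitFunction_apply_self one_ne_zero hinv,
    fun e he => ((hball (hdist e he)).1).trans h₀⟩

theorem IsQuarterPeriod.exists_isEvenFamily (h : IsQuarterPeriod ξ s) (hp : p ≠ 0)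
    (hs : p * (2 * s) = m * Real.pi) : ∃ e₀ Ξ, IsEvenFamily m p e₀ Ξ := by
  have hXDot : XDot (m * Real.pi) ξ 0 = 0 := by
    simpa [← hs, XDot_zero_init] using (XDot_zero_antiperiodic h.eq_zero).add_nat_mul_eq p (x := 0)
  obtain ⟨e₀, Ξ, hpos, hle, hdiff, rfl, hzero⟩ := exists_contDiffOn_XDot_eq_zero (by positivity)
    hXDot (hs ▸ h.hillVel_nat_mul_ne_zero hp)
  have hperiod : 2 * m * Real.pi / p = 4 * s := by
    rw [div_eq_iff (Nat.cast_ne_zero.2 hp)]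
    linarith
  exact ⟨e₀, Ξ, hpos, hle, hdiff, h.start_pos, hperiod ▸ h.hasMinimalPeriod, hzero⟩

theorem sq_ne_eight_mul_sq (hm : m ≠ 0) : p ^ 2 ≠ 8 * m ^ 2 := by
  intro h
  refine irrational_sqrt_two ⟨(p : ℚ) / (2 * m), ?_⟩
  have hm₀ : (m : ℝ) ≠ 0 := Nat.cast_ne_zero.2 hm
  have hR : (p : ℝ) ^ 2 = 8 * m ^ 2 := mod_cast h
  push_cast
  rw [eq_comm, Real.sqrt_eq_iff_mul_self_eq (by norm_num) (by positivity)]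
  field_simp
  linarith

theorem sq_lt_eight_mul_sq (hm : m ≠ 0) (h : p ≤ ⌊Real.sqrt 8 * m⌋₊) : p ^ 2 < 8 * m ^ 2 := by
  refine lt_of_le_of_ne ?_ (sq_ne_eight_mul_sq hm)
  have hle : (p : ℝ) ≤ Real.sqrt 8 * m := (Nat.cast_le.2 h).trans (Nat.floor_le (by positivity))
  have hsq := pow_le_pow_left₀ p.cast_nonneg hle 2
  rw [mul_pow, Real.sq_sqrt (by norm_num)] at hsq
  exact_mod_cast hsq

theorem exists_isEvenFamily (hp : 1 ≤ p) (hpm : p ≤ ⌊Real.sqrt 8 * m⌋₊) :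
    ∃ e₀ Ξ, IsEvenFamily m p e₀ Ξ := by
  have hm : m ≠ 0 := by
    rintro rfl
    simp only [Nat.cast_zero, mul_zero, Nat.floor_zero] at hpm
    omega
  have hp₀ : (0 : ℝ) < p := Nat.cast_pos.2 hp
  have hm₀ : (0 : ℝ) < m := Nat.cast_pos.2 (Nat.pos_of_ne_zero hm)
  have hs : 0 < m * Real.pi / (2 * p) := div_pos (mul_pos hm₀ Real.pi_pos) (mul_pos two_pos hp₀)
  have hfreq : (Real.pi / (2 * (m * Real.pi / (2 * p)))) ^ 2 < 8 := by
    have hratio : Real.pi / (2 * (m * Real.pi / (2 * p))) = p / m := by field_simp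
    rw [hratio, div_pow, div_lt_iff₀ (pow_pos hm₀ 2)]
    exact_mod_cast sq_lt_eight_mul_sq hm hpm
  obtain ⟨ξ, hξ⟩ := exists_isQuarterPeriod hs hfreq
  exact hξ.exists_isEvenFamily (Nat.one_le_iff_ne_zero.1 hp) (by field_simp)

end Continuation

end Sitnikov

theorem theorem4p3 (m p : ℕ) (hp : 1 ≤ p) (hpm : p ≤ ⌊Real.sqrt 8 * m⌋₊)
    (hne : ∀ n : ℕ, 1 ≤ n → (p : ℝ) / m ≠ 1 / (2 * n)) :
    (∃ (e₀ : ℝ) (Ξ : ℝ → ℝ), Sitnikov.IsEvenFamily m p e₀ Ξ) ∧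
      ∀ (e₀ : ℝ) (Ξ : ℝ → ℝ), Sitnikov.IsEvenFamily m p e₀ Ξ →
        HasDerivWithinAt (Sitnikov.trace m Ξ) 0 (Set.Ici 0) 0 :=
  ⟨Sitnikov.exists_isEvenFamily hp hpm, fun _ _ hΞ => hΞ.hasDerivWithinAt_trace hne⟩
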